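/- Let $\Gamma$ be a torsionless grading monoid, i.e. a commutative cancellative monoid, written additively, whose quotient group $\langle\Gamma\rangle$ is torsion-free, and let $R=\bigoplus_{\alpha\in\Gamma}R_\alpha$ be a $\Gamma$-graded integral domain with quotient field $K$. Assume that $R_0\subset R$ is inert: whenever $x,y\in R$ and $0\neq xy\in R_0$, there are $r,s\in R_0$ and a unit $u$ of $R$ with $x=ru$ and $y=su^{-1}$. For a nonzero fractional ideal $I$ of $R$ put $I^{-1}=\{x\in K: xI\subseteq R\}$, $I_v=(I^{-1})^{-1}$ and $I_t=\bigcup\{J_v : J\subseteq I \text{ a nonzero finitely generated fractional ideal}\}$; $I$ is a $t$-ideal if $I_t=I$. The fractional $t$-ideals form a commutative monoid with unit $R$ under $(I,J)\mapsto (IJ)_t$, whose group of invertible elements is denoted $T(R)$. Let $P(R)$ be the subgroup of nonzero principal fractional ideals, and let $Cl(R)=T(R)/P(R)$. A fractional ideal $I$ is homogeneous if $sI$ is a homogeneous ideal of $R$ for some nonzero homogeneous $s\in R$. Let $HT(R)$ be the subgroup of homogeneous members of $T(R)$, let $HP(R)=HT(R)\cap P(R)$, and let $HCl(R)=HT(R)/HP(R)$,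 regarded as a subgroup of $Cl(R)$. Let $S$ be the set of nonzero homogeneous elements of $R$, and grade $R_S\subseteq K$ by $\langle\Gamma\rangle$ via $(R_S)_\alpha=\{a/b : a\in R_\beta,\ 0\ne b\in R_\gamma,\ \alpha=\beta-\gamma\}$. Then $Cl(R)=HCl(R)$ if and only if $R$ is almost normal, i.e. every homogeneous element of $R_S$ of nonzero degree that is integral over $R$ lies in $R$. -/

import Mathlib

namespace GradedClassGroup

set_option linter.unusedSectionVars false

section TOperation

open scoped nonZeroDivisors
open FractionalIdeal

variable {R : Type*} [CommRing R] [IsDomain R] {K : Type*} [Field K] [Algebra R K]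
  [IsFractionRing R K]

/-- The divisorial closure `I_v = (I⁻¹)⁻¹`, where `I⁻¹ = (R : I)` (for `I ≠ 0`). -/
noncomputable def vClosure (I : FractionalIdeal R⁰ K) : FractionalIdeal R⁰ K := (I⁻¹)⁻¹

theorem mul_mem_one_of_mem_inv {I : FractionalIdeal R⁰ K} {x y : K} (hx : x ∈ I⁻¹) (hy : y ∈ I) :
    x * y ∈ (1 : FractionalIdeal R⁰ K) := by
  by_cases hI : I = 0
  · subst hI
    rw [mem_zero_iff] at hy
    simp [hy]
  · exact (mem_inv_iff hI).1 hx y hy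

theorem inv_ne_zero' {I : FractionalIdeal R⁰ K} (hI : I ≠ 0) : I⁻¹ ≠ 0 := by
  obtain ⟨a, J, ha, h⟩ := exists_eq_spanSingleton_mul I
  have ha' : algebraMap R K a ≠ 0 := by simpa using ha
  intro h0
  have : algebraMap R K a ∈ I⁻¹ := by
    rw [mem_inv_iff hI]
    intro y hy
    rw [h, mem_singleton_mul] at hy
    obtain ⟨y', hy', rfl⟩ := hy
    rw [mul_inv_cancel_left₀ ha']
    exact coeIdeal_le_one hy'
  rw [h0, mem_zero_iff] at this
  exact ha' this

theorem mem_vClosure {I : FractionalIdeal R⁰ K} (hI : I ≠ 0) {x : K} :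
    x ∈ vClosure I ↔ ∀ z, (∀ y ∈ I, z * y ∈ (1 : FractionalIdeal R⁰ K)) →
      x * z ∈ (1 : FractionalIdeal R⁰ K) := by
  rw [vClosure, mem_inv_iff (inv_ne_zero' hI)]
  simp only [mem_inv_iff hI]

theorem mul_ne_zero' {I J : FractionalIdeal R⁰ K} (hI : I ≠ 0) (hJ : J ≠ 0) : I * J ≠ 0 := by
  obtain ⟨x, hx, hx0⟩ := (Submodule.ne_bot_iff (I : Submodule R K)).1 (fun h => hI (coeToSubmodule_eq_bot.1 h))
  obtain ⟨y, hy, hy0⟩ := (Submodule.ne_bot_iff (J : Submodule R K)).1 (fun h => hJ (coeToSubmodule_eq_bot.1 h))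
  intro h
  have := mul_mem_mul (I := I) (J := J) hx hy
  rw [h, mem_zero_iff] at this
  exact mul_ne_zero hx0 hy0 this

theorem vClosure_zero : vClosure (0 : FractionalIdeal R⁰ K) = 0 := by
  simp [vClosure, inv_zero']

theorem le_vClosure (I : FractionalIdeal R⁰ K) : I ≤ vClosure I := by
  by_cases hI : I = 0
  · subst hI; rw [vClosure_zero]
  · intro x hx
    exact (mem_vClosure hI).2 fun z hz => by rw [mul_comm]; exact hz x hx

theorem vClosure_le_of_le {I J : FractionalIdeal R⁰ K} (h : I ≤ vClosure J) :
    vClosure I ≤ vClosure J := by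
  by_cases hI : I = 0
  · subst hI; rw [vClosure_zero]; exact bot_le
  have hJ : J ≠ 0 := by
    rintro rfl
    rw [vClosure_zero] at h
    exact hI (le_antisymm h bot_le)
  intro x hx
  refine (mem_vClosure hJ).2 fun z hz => (mem_vClosure hI).1 hx z fun y hy => ?_
  rw [mul_comm]
  exact (mem_vClosure hJ).1 (h hy) z hz

theorem vClosure_mono {I J : FractionalIdeal R⁰ K} (h : I ≤ J) : vClosure I ≤ vClosure J :=
  vClosure_le_of_le (h.trans (le_vClosure J))

theorem sup_fg {I J : FractionalIdeal R⁰ K} (hI : (I : Submodule R K).FG)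
    (hJ : (J : Submodule R K).FG) : ((I ⊔ J : FractionalIdeal R⁰ K) : Submodule R K).FG := by
  rw [coe_sup]; exact hI.sup hJ

/-- The `t`-closure `I_t`: the union of the `J_v` over the finitely generated `J ⊆ I`. -/
noncomputable def tClosure (I : FractionalIdeal R⁰ K) : FractionalIdeal R⁰ K :=
  ⟨{ carrier := {x | ∃ J : FractionalIdeal R⁰ K, J ≤ I ∧ (J : Submodule R K).FG ∧ x ∈ vClosure J}
     zero_mem' := ⟨0, bot_le, by simpa using Submodule.fg_bot, FractionalIdeal.zero_mem _⟩
     add_mem' := by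
       rintro x y ⟨J, hJ, hJf, hx⟩ ⟨J', hJ', hJf', hy⟩
       exact ⟨J ⊔ J', sup_le hJ hJ', sup_fg hJf hJf',
         Submodule.add_mem (vClosure (J ⊔ J') : Submodule R K) (vClosure_mono le_sup_left hx)
           (vClosure_mono le_sup_right hy)⟩
     smul_mem' := by
       rintro r x ⟨J, hJ, hJf, hx⟩
       exact ⟨J, hJ, hJf, Submodule.smul_mem (vClosure J : Submodule R K) r hx⟩ },
   isFractional_of_le (J := vClosure I) (by
     rintro x ⟨J, hJ, -, hx⟩
     exact vClosure_mono hJ hx)⟩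

theorem mem_tClosure {I : FractionalIdeal R⁰ K} {x : K} :
    x ∈ tClosure I ↔
      ∃ J : FractionalIdeal R⁰ K, J ≤ I ∧ (J : Submodule R K).FG ∧ x ∈ vClosure J := Iff.rfl

theorem spanSingleton_fg (x : K) : ((spanSingleton R⁰ x : FractionalIdeal R⁰ K) :
    Submodule R K).FG := by
  rw [coe_spanSingleton]; exact Submodule.fg_span_singleton x

theorem le_tClosure (I : FractionalIdeal R⁰ K) : I ≤ tClosure I := fun x hx =>
  ⟨spanSingleton R⁰ x, spanSingleton_le_iff_mem.2 hx, spanSingleton_fg x,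
    le_vClosure _ (mem_spanSingleton_self _ x)⟩

theorem tClosure_le_vClosure (I : FractionalIdeal R⁰ K) : tClosure I ≤ vClosure I := by
  rintro x ⟨J, hJ, -, hx⟩
  exact vClosure_mono hJ hx

theorem tClosure_mono {I J : FractionalIdeal R⁰ K} (h : I ≤ J) : tClosure I ≤ tClosure J := by
  rintro x ⟨J', hJ, hf, hx⟩
  exact ⟨J', hJ.trans h, hf, hx⟩

theorem exists_fg_of_le_tClosure {I J : FractionalIdeal R⁰ K} (hJ : (J : Submodule R K).FG)
    (h : J ≤ tClosure I) : ∃ J' : FractionalIdeal R⁰ K, J' ≤ I ∧ (J' : Submodule R K).FG ∧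
      J ≤ vClosure J' := by
  obtain ⟨s, hs⟩ := hJ
  have key : ∀ s : Finset K, (∀ x ∈ s, x ∈ tClosure I) →
      ∃ J' : FractionalIdeal R⁰ K, J' ≤ I ∧ (J' : Submodule R K).FG ∧
        ∀ x ∈ s, x ∈ vClosure J' := by
    classical
    intro s
    induction s using Finset.induction_on with
    | empty => intro _; exact ⟨0, bot_le, by simpa using Submodule.fg_bot, by simp⟩
    | insert a s ha ih =>
      intro h
      obtain ⟨J₁, h₁, hf₁, hx₁⟩ := ih fun x hx => h x (Finset.mem_insert_of_mem hx)
      obtain ⟨J₂, h₂, hf₂, hx₂⟩ := h a (Finset.mem_insert_self _ _)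
      refine ⟨J₁ ⊔ J₂, sup_le h₁ h₂, sup_fg hf₁ hf₂, fun x hx => ?_⟩
      rcases Finset.mem_insert.1 hx with rfl | hx
      · exact vClosure_mono le_sup_right hx₂
      · exact vClosure_mono le_sup_left (hx₁ x hx)
  obtain ⟨J', h₁, h₂, h₃⟩ := key s fun x hx => h (by
    rw [← mem_coe, ← hs]; exact Submodule.subset_span hx)
  refine ⟨J', h₁, h₂, ?_⟩
  rw [← coe_le_coe, ← hs, Submodule.span_le]
  exact h₃

theorem tClosure_tClosure (I : FractionalIdeal R⁰ K) : tClosure (tClosure I) = tClosure I := by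
  refine le_antisymm ?_ (le_tClosure _)
  rintro x ⟨J, hJ, hf, hx⟩
  obtain ⟨J', h₁, h₂, h₃⟩ := exists_fg_of_le_tClosure hf hJ
  exact ⟨J', h₁, h₂, vClosure_le_of_le h₃ hx⟩

theorem tClosure_le_of_le {I J : FractionalIdeal R⁰ K} (h : I ≤ tClosure J) :
    tClosure I ≤ tClosure J := (tClosure_mono h).trans (tClosure_tClosure J).le

theorem mul_mem_vClosure {J : FractionalIdeal R⁰ K} {x y : K} (hy : y ∈ vClosure J) :
    x * y ∈ vClosure (spanSingleton R⁰ x * J) := by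
  by_cases hJ : J = 0
  · subst hJ
    rw [vClosure_zero, mem_zero_iff] at hy
    simpa [hy] using FractionalIdeal.zero_mem _
  by_cases hx : x = 0
  · simpa [hx] using FractionalIdeal.zero_mem _
  have h0 : spanSingleton R⁰ x * J ≠ 0 := mul_ne_zero' (spanSingleton_ne_zero_iff.2 hx) hJ
  refine (mem_vClosure h0).2 fun z hz => ?_
  have := (mem_vClosure hJ).1 hy (z * x) fun j hj => by
    rw [mul_assoc]
    exact hz _ (mem_singleton_mul.2 ⟨j, hj, rfl⟩)
  convert this using 1
  ring

theorem mul_tClosure_le (I J : FractionalIdeal R⁰ K) : I * tClosure J ≤ tClosure (I * J) := by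
  rw [mul_le]
  rintro x hx y ⟨J', h, hf, hy⟩
  refine ⟨spanSingleton R⁰ x * J', mul_le_mul' (spanSingleton_le_iff_mem.2 hx) h, ?_,
    mul_mem_vClosure hy⟩
  rw [coe_mul]
  exact (spanSingleton_fg x).mul hf

theorem tClosure_mul_tClosure (I J : FractionalIdeal R⁰ K) :
    tClosure (I * tClosure J) = tClosure (I * J) :=
  le_antisymm (tClosure_le_of_le (mul_tClosure_le I J))
    (tClosure_mono (mul_le_mul' le_rfl (le_tClosure J)))

theorem tClosure_ne_zero {I : FractionalIdeal R⁰ K} (h : I ≠ 0) : tClosure I ≠ 0 := fun h0 =>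
  h (le_antisymm ((le_tClosure I).trans h0.le) bot_le)

theorem tClosure_spanSingleton (x : K) :
    tClosure (spanSingleton R⁰ x) = (spanSingleton R⁰ x : FractionalIdeal R⁰ K) := by
  refine le_antisymm ((tClosure_le_vClosure _).trans ?_) (le_tClosure _)
  rw [vClosure, inv_eq, inv_eq, one_div_spanSingleton, one_div_spanSingleton, inv_inv]

theorem tClosure_one : tClosure (1 : FractionalIdeal R⁰ K) = 1 := by
  rw [← spanSingleton_one, tClosure_spanSingleton]

variable (R K)

/-- The nonzero fractional `t`-ideals of `R` (with quotient field `K`). -/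
structure TIdeal where
  /-- The underlying fractional ideal. -/
  ideal : FractionalIdeal R⁰ K
  ne_zero : ideal ≠ 0
  tClosure_eq : tClosure ideal = ideal

variable {R K}

theorem TIdeal.ext' {I J : TIdeal R K} (h : I.ideal = J.ideal) : I = J := by
  cases I; cases J; cases h; rfl

/-- The `t`-ideals form a commutative monoid under the `t`-multiplication `(I, J) ↦ (IJ)_t`. -/
noncomputable instance : CommMonoid (TIdeal R K) where
  mul I J := ⟨tClosure (I.ideal * J.ideal), tClosure_ne_zero (mul_ne_zero' I.ne_zero J.ne_zero),
    tClosure_tClosure _⟩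
  one := ⟨1, one_ne_zero, tClosure_one⟩
  mul_assoc I J L := TIdeal.ext' (by
    change tClosure (tClosure (I.ideal * J.ideal) * L.ideal) =
      tClosure (I.ideal * tClosure (J.ideal * L.ideal))
    rw [tClosure_mul_tClosure, mul_comm, tClosure_mul_tClosure, mul_comm, mul_assoc])
  one_mul I := TIdeal.ext' (by
    change tClosure (1 * I.ideal) = I.ideal
    rw [one_mul, I.tClosure_eq])
  mul_one I := TIdeal.ext' (by
    change tClosure (I.ideal * 1) = I.ideal
    rw [mul_one, I.tClosure_eq])
  mul_comm I J := TIdeal.ext' (by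
    change tClosure (I.ideal * J.ideal) = tClosure (J.ideal * I.ideal)
    rw [mul_comm])

theorem TIdeal.mul_ideal (I J : TIdeal R K) : (I * J).ideal = tClosure (I.ideal * J.ideal) := rfl

theorem TIdeal.one_ideal : (1 : TIdeal R K).ideal = 1 := rfl

variable (R K)

/-- The group of `t`-invertible fractional `t`-ideals of `R`: the invertible elements of
the monoid of `t`-ideals. -/
abbrev TInvertible : Type _ := (TIdeal R K)ˣ

/-- The nonzero principal fractional ideal `xR`, as a `t`-ideal. -/
noncomputable def principalTIdeal : Kˣ →* TIdeal R K where
  toFun x := ⟨spanSingleton R⁰ (x : K), spanSingleton_ne_zero_iff.2 x.ne_zero,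
    tClosure_spanSingleton _⟩
  map_one' := TIdeal.ext' (by
    change spanSingleton R⁰ ((1 : Kˣ) : K) = 1
    rw [Units.val_one, spanSingleton_one])
  map_mul' x y := TIdeal.ext' (by
    change spanSingleton R⁰ ((x * y : Kˣ) : K) =
      tClosure (spanSingleton R⁰ (x : K) * spanSingleton R⁰ (y : K))
    rw [spanSingleton_mul_spanSingleton, tClosure_spanSingleton, Units.val_mul])

/-- The subgroup of principal fractional ideals. -/
noncomputable def principalSubgroup : Subgroup (TInvertible R K) :=
  (principalTIdeal R K).toHomUnits.range

/-- The (`t`-)class group `Cl(R)`: `t`-invertible fractional `t`-ideals modulo principal ones. -/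
abbrev TClassGroup : Type _ := TInvertible R K ⧸ principalSubgroup R K

end TOperation

section Graded

open scoped nonZeroDivisors
open FractionalIdeal

variable {Γ : Type*} [AddCancelCommMonoid Γ] [DecidableEq Γ]
  {R : Type*} [CommRing R] [IsDomain R] {K : Type*} [Field K] [Algebra R K] [IsFractionRing R K]
  (A : Γ → AddSubgroup R) [GradedRing A]

/-- A fractional ideal `I` is homogeneous if `sI` is a homogeneous integral ideal of `R` for some
nonzero homogeneous `s ∈ R`. -/
def IsHomogeneousFractional (I : FractionalIdeal R⁰ K) : Prop :=
  ∃ s : R, s ≠ 0 ∧ SetLike.IsHomogeneousElem A s ∧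
    ∃ H : Ideal R, H.IsHomogeneous A ∧ spanSingleton R⁰ (algebraMap R K s) * I = H

variable {A}

theorem isHomogeneous_of_mul {s : R} (hsh : SetLike.IsHomogeneousElem A s)
    {H H' : Ideal R} (hH' : H'.IsHomogeneous A) (h : ∀ x, x ∈ H ↔ s * x ∈ H') :
    H.IsHomogeneous A := by
  obtain ⟨d, hd⟩ := hsh
  intro i x hx
  rw [h, ← DirectSum.coe_decompose_mul_add_of_left_mem A hd]
  exact hH' _ ((h x).1 hx)

theorem algebraMap_mem_coeIdeal {H : Ideal R} {x : R} :
    algebraMap R K x ∈ (H : FractionalIdeal R⁰ K) ↔ x ∈ H := by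
  rw [mem_coeIdeal]
  constructor
  · rintro ⟨y, hy, e⟩
    rwa [← IsFractionRing.injective R K e]
  · exact fun h => ⟨x, h, rfl⟩

theorem isHomogeneous_of_coeIdeal {H : Ideal R}
    (h : IsHomogeneousFractional A (H : FractionalIdeal R⁰ K)) : H.IsHomogeneous A := by
  obtain ⟨s, hs, hsh, H', hH', e⟩ := h
  refine isHomogeneous_of_mul hsh hH' fun x => ?_
  have hs' : algebraMap R K s ≠ 0 := by simpa using hs
  rw [← algebraMap_mem_coeIdeal (K := K) (x := s * x), ← e, map_mul, mem_singleton_mul]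
  constructor
  · intro hx
    exact ⟨_, algebraMap_mem_coeIdeal.2 hx, rfl⟩
  · rintro ⟨y, hy, hxy⟩
    rw [mul_right_inj' hs'] at hxy
    subst hxy
    exact algebraMap_mem_coeIdeal.1 hy

theorem isHomogeneousFractional_coeIdeal {H : Ideal R} (h : H.IsHomogeneous A) :
    IsHomogeneousFractional A (H : FractionalIdeal R⁰ K) :=
  ⟨1, one_ne_zero, ⟨0, SetLike.GradedOne.one_mem⟩, H, h, by simp⟩

theorem exists_homogeneous_mem {H : Ideal R} (h : H.IsHomogeneous A) (h0 : H ≠ ⊥) :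
    ∃ x ∈ H, x ≠ 0 ∧ SetLike.IsHomogeneousElem A x := by
  classical
  obtain ⟨x, hx, hx0⟩ := (Submodule.ne_bot_iff H).1 h0
  by_contra! hc
  apply hx0
  rw [← DirectSum.sum_support_decompose A x]
  refine Finset.sum_eq_zero fun i _ => ?_
  by_contra hi
  exact hc _ (h i hx) hi ⟨i, SetLike.coe_mem _⟩

theorem isHomogeneous_colon {H L : Ideal R} (hH : H.IsHomogeneous A) (hL : L.IsHomogeneous A)
    {M : Ideal R} (hM : ∀ r, r ∈ M ↔ ∀ g ∈ H, r * g ∈ L) : M.IsHomogeneous A := by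
  classical
  intro i r hr
  rw [hM] at hr ⊢
  intro g hg
  rw [← DirectSum.sum_support_decompose A g, Finset.mul_sum]
  refine Ideal.sum_mem _ fun j _ => ?_
  rw [← DirectSum.coe_decompose_mul_add_of_right_mem A (SetLike.coe_mem _)]
  exact hL _ (hr _ (hH j hg))

theorem IsHomogeneousFractional.inv {I : FractionalIdeal R⁰ K} (hI : I ≠ 0)
    (h : IsHomogeneousFractional A I) : IsHomogeneousFractional A I⁻¹ := by
  obtain ⟨s, hs, hsh, H, hH, e⟩ := h
  have hs' : algebraMap R K s ≠ 0 := by simpa using hs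
  have hH0 : H ≠ ⊥ := by
    rintro rfl
    rw [coeIdeal_bot] at e
    exact mul_ne_zero' (spanSingleton_ne_zero_iff.2 hs') hI e
  obtain ⟨a, ha, ha0, hah⟩ := exists_homogeneous_mem hH hH0
  have ha' : algebraMap R K a ≠ 0 := by simpa using ha0
  have hIH : ∀ y, y ∈ I ↔ algebraMap R K s * y ∈ (H : FractionalIdeal R⁰ K) := by
    intro y
    rw [← e, mem_singleton_mul]
    constructor
    · exact fun hy => ⟨y, hy, rfl⟩
    · rintro ⟨z, hz, hzy⟩
      rwa [mul_left_cancel₀ hs' hzy]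
  let M : Ideal R :=
    { carrier := {r | ∀ g ∈ H, r * g ∈ Ideal.span {a * s}}
      zero_mem' := fun g _ => by simp
      add_mem' := fun hx hy g hg => by
        rw [add_mul]; exact Ideal.add_mem _ (hx g hg) (hy g hg)
      smul_mem' := fun c x hx g hg => by
        rw [smul_eq_mul, mul_assoc]; exact Ideal.mul_mem_left _ _ (hx g hg) }
  have hspan : (Ideal.span {a * s}).IsHomogeneous A :=
    Ideal.homogeneous_span A _ fun x hx => by
      rw [Set.mem_singleton_iff.1 hx]; exact hah.mul hsh
  refine ⟨a, ha0, hah, M, isHomogeneous_colon hH hspan (M := M) fun r => Iff.rfl, ?_⟩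
  have key : ∀ x, x ∈ I⁻¹ ↔ ∀ g ∈ H, ∃ c : R, x * algebraMap R K g =
      algebraMap R K c * algebraMap R K s := by
    intro x
    rw [mem_inv_iff hI]
    constructor
    · intro hx g hg
      have := hx ((algebraMap R K s)⁻¹ * algebraMap R K g) (by
        rw [hIH, mul_inv_cancel_left₀ hs']; exact algebraMap_mem_coeIdeal.2 hg)
      obtain ⟨c, hc⟩ := (mem_one_iff _).1 this
      refine ⟨c, ?_⟩
      rw [hc]; field_simp
    · intro hx y hy
      obtain ⟨g, hg, hgy⟩ := (mem_coeIdeal _).1 ((hIH y).1 hy)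
      obtain ⟨c, hc⟩ := hx g hg
      refine (mem_one_iff _).2 ⟨c, ?_⟩
      apply mul_left_cancel₀ hs'
      rw [mul_comm, ← hc, hgy]; ring
  ext y
  rw [mem_singleton_mul, mem_coeIdeal]
  constructor
  · rintro ⟨x, hx, rfl⟩
    rw [key] at hx
    obtain ⟨c, hc⟩ := hx a ha
    refine ⟨c * s, ?_, by rw [map_mul, ← hc, mul_comm]⟩
    intro g hg
    obtain ⟨d, hd⟩ := hx g hg
    rw [Ideal.mem_span_singleton]
    refine ⟨d, IsFractionRing.injective R K ?_⟩
    simp only [map_mul]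
    rw [← hc, mul_right_comm, hd]; ring
  · rintro ⟨r, hr, rfl⟩
    refine ⟨(algebraMap R K a)⁻¹ * algebraMap R K r, ?_, by rw [mul_inv_cancel_left₀ ha']⟩
    rw [key]
    intro g hg
    obtain ⟨d, hd⟩ := Ideal.mem_span_singleton.1 (hr g hg)
    refine ⟨d, ?_⟩
    have := congrArg (algebraMap R K) hd
    simp only [map_mul] at this
    rw [mul_assoc, this]; field_simp

theorem IsHomogeneousFractional.mul {I J : FractionalIdeal R⁰ K}
    (hI : IsHomogeneousFractional A I) (hJ : IsHomogeneousFractional A J) :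
    IsHomogeneousFractional A (I * J) := by
  obtain ⟨s, hs, hsh, H, hH, e⟩ := hI
  obtain ⟨s', hs', hsh', H', hH', e'⟩ := hJ
  refine ⟨s * s', mul_ne_zero hs hs', hsh.mul hsh', H * H', hH.mul hH', ?_⟩
  rw [coeIdeal_mul, ← e, ← e', map_mul, ← spanSingleton_mul_spanSingleton]
  ring

theorem IsHomogeneousFractional.vClosure {I : FractionalIdeal R⁰ K} (hI : I ≠ 0)
    (h : IsHomogeneousFractional A I) : IsHomogeneousFractional A (vClosure I) :=
  (h.inv hI).inv (inv_ne_zero' hI)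

theorem exists_homogeneous_fg {H : Ideal R} (hH : H.IsHomogeneous A) {F : FractionalIdeal R⁰ K}
    (hF : F ≤ (H : FractionalIdeal R⁰ K)) (hfg : (F : Submodule R K).FG) :
    ∃ L : Ideal R, L.FG ∧ L.IsHomogeneous A ∧ L ≤ H ∧ F ≤ (L : FractionalIdeal R⁰ K) := by
  classical
  obtain ⟨t, ht⟩ := hfg
  have hmem : ∀ x ∈ t, ∃ y ∈ H, algebraMap R K y = x := fun x hx => (mem_coeIdeal _).1 (hF (by
    rw [← mem_coe, ← ht]; exact Submodule.subset_span hx))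
  choose! f hf hfx using hmem
  let T : Finset R := t.biUnion fun x =>
    (DFinsupp.support (DirectSum.decompose A (f x))).image fun i =>
      ((DirectSum.decompose A (f x) i : A i) : R)
  refine ⟨Ideal.span (T : Set R), ⟨T, rfl⟩, Ideal.homogeneous_span A _ ?_, ?_, ?_⟩
  · intro y hy
    simp only [T, Finset.coe_biUnion, Set.mem_iUnion, Finset.coe_image, Set.mem_image] at hy
    obtain ⟨x, -, i, -, rfl⟩ := hy
    exact ⟨i, SetLike.coe_mem _⟩
  · rw [Ideal.span_le]
    intro y hy
    simp only [T, Finset.coe_biUnion, Set.mem_iUnion, Finset.coe_image, Set.mem_image] at hy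
    obtain ⟨x, hx, i, -, rfl⟩ := hy
    exact hH i (hf x hx)
  · rw [← coe_le_coe, ← ht, Submodule.span_le]
    intro x hx
    change x ∈ ((Ideal.span (T : Set R) : Ideal R) : FractionalIdeal R⁰ K)
    rw [← hfx x hx, algebraMap_mem_coeIdeal, ← DirectSum.sum_support_decompose A (f x)]
    refine Ideal.sum_mem _ fun i hi => Ideal.subset_span ?_
    exact Finset.mem_biUnion.2 ⟨x, hx, Finset.mem_image.2 ⟨i, hi, rfl⟩⟩

theorem spanSingleton_mul_tClosure {x : K} (hx : x ≠ 0) (I : FractionalIdeal R⁰ K) :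
    spanSingleton R⁰ x * tClosure I = tClosure (spanSingleton R⁰ x * I) := by
  refine le_antisymm (mul_tClosure_le _ _) ?_
  have h := mul_tClosure_le (spanSingleton R⁰ x⁻¹) (spanSingleton R⁰ x * I)
  have h1 : spanSingleton R⁰ x * spanSingleton R⁰ x⁻¹ = 1 := by
    rw [spanSingleton_mul_spanSingleton, mul_inv_cancel₀ hx, spanSingleton_one]
  rw [← mul_assoc, mul_comm (spanSingleton R⁰ x⁻¹) (spanSingleton R⁰ x), h1, one_mul] at h
  calc tClosure (spanSingleton R⁰ x * I)
      = spanSingleton R⁰ x * (spanSingleton R⁰ x⁻¹ * tClosure (spanSingleton R⁰ x * I)) := by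
        rw [← mul_assoc, h1, one_mul]
    _ ≤ _ := mul_le_mul' le_rfl h

theorem IsHomogeneousFractional.tClosure {I : FractionalIdeal R⁰ K}
    (h : IsHomogeneousFractional A I) : IsHomogeneousFractional A (tClosure I) := by
  obtain ⟨s, hs, hsh, H, hH, e⟩ := h
  have hs' : algebraMap R K s ≠ 0 := by simpa using hs
  have hle : GradedClassGroup.tClosure (H : FractionalIdeal R⁰ K) ≤ 1 := by
    rw [← tClosure_one]; exact tClosure_mono coeIdeal_le_one
  obtain ⟨H', hH'⟩ := le_one_iff_exists_coeIdeal.1 hle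
  refine ⟨s, hs, hsh, H', ?_, by rw [spanSingleton_mul_tClosure hs', e, hH']⟩
  intro i x hx
  rw [← algebraMap_mem_coeIdeal (K := K), hH'] at hx ⊢
  obtain ⟨F, hF, hfg, hx⟩ := hx
  obtain ⟨L, hLfg, hL, hLH, hFL⟩ := exists_homogeneous_fg hH hF hfg
  by_cases hL0 : L = ⊥
  · subst hL0
    have hx0 := vClosure_mono hFL hx
    rw [coeIdeal_bot, vClosure_zero, mem_zero_iff] at hx0
    have hx0' : x = 0 := by simpa using hx0
    subst hx0'
    simpa using FractionalIdeal.zero_mem _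
  have hL0' : (L : FractionalIdeal R⁰ K) ≠ 0 := by simpa using hL0
  have hv : GradedClassGroup.vClosure (L : FractionalIdeal R⁰ K) ≤ 1 := by
    refine (vClosure_mono coeIdeal_le_one).trans ?_
    simp [GradedClassGroup.vClosure]
  obtain ⟨V, hV⟩ := le_one_iff_exists_coeIdeal.1 hv
  have hVh : V.IsHomogeneous A := isHomogeneous_of_coeIdeal (K := K) (by
    rw [hV]; exact (isHomogeneousFractional_coeIdeal hL).vClosure hL0')
  have hxV : x ∈ V := by
    rw [← algebraMap_mem_coeIdeal (K := K), hV]; exact vClosure_mono hFL hx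
  refine ⟨L, coeIdeal_le_coeIdeal K |>.2 hLH, ?_, ?_⟩
  · rw [coe_coeIdeal]; exact Submodule.FG.map (Algebra.linearMap R K) hLfg
  · rw [← hV]; exact algebraMap_mem_coeIdeal.2 (hVh i hxV)

theorem TInvertible.inv_ideal (I : TInvertible R K) :
    ((I⁻¹ : TInvertible R K) : TIdeal R K).ideal = (I : TIdeal R K).ideal⁻¹ := by
  have hmul : GradedClassGroup.tClosure ((I : TIdeal R K).ideal *
      ((I⁻¹ : TInvertible R K) : TIdeal R K).ideal) = 1 := by
    rw [← TIdeal.mul_ideal, Units.mul_inv, TIdeal.one_ideal]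
  refine le_antisymm ?_ ?_
  · intro x hx
    refine (mem_inv_iff (I : TIdeal R K).ne_zero).2 fun y hy => ?_
    rw [mul_comm, ← hmul]
    exact le_tClosure _ (mul_mem_mul hy hx)
  · have h := mul_tClosure_le ((I : TIdeal R K).ideal⁻¹) ((I : TIdeal R K).ideal *
      ((I⁻¹ : TInvertible R K) : TIdeal R K).ideal)
    rw [hmul, mul_one, ← mul_assoc] at h
    refine h.trans ?_
    conv_rhs => rw [← ((I⁻¹ : TInvertible R K) : TIdeal R K).tClosure_eq]
    refine tClosure_mono ?_
    calc _ ≤ 1 * ((I⁻¹ : TInvertible R K) : TIdeal R K).ideal := by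
          refine mul_le_mul' ?_ le_rfl
          rw [mul_le]
          exact fun i hi j hj => mul_mem_one_of_mem_inv hi hj
      _ = _ := one_mul _

variable (A) (K)

/-- The group of homogeneous `t`-invertible fractional `t`-ideals. -/
noncomputable def homogeneousTInvertible : Subgroup (TInvertible R K) where
  carrier := {I | IsHomogeneousFractional A (I : TIdeal R K).ideal}
  one_mem' := by
    have htop : (⊤ : Ideal R).IsHomogeneous A := fun _ _ _ => trivial
    have := isHomogeneousFractional_coeIdeal (K := K) htop
    rwa [coeIdeal_top] at this
  mul_mem' := fun hI hJ => (IsHomogeneousFractional.mul hI hJ).tClosure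
  inv_mem' := fun {I} hI => by
    change IsHomogeneousFractional A _
    rw [TInvertible.inv_ideal]
    exact IsHomogeneousFractional.inv (I : TIdeal R K).ne_zero hI

/-- The homogeneous class group `HCl(R)`: homogeneous `t`-invertible fractional `t`-ideals modulo
homogeneous principal fractional ideals. -/
abbrev HomogeneousClassGroup : Type _ :=
  homogeneousTInvertible K A ⧸ (principalSubgroup R K).subgroupOf (homogeneousTInvertible K A)

/-- The canonical map `HCl(R) → Cl(R)` induced by the inclusion of ideals. -/
noncomputable def HomogeneousClassGroup.toClassGroup :
    HomogeneousClassGroup K A →* TClassGroup R K :=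
  QuotientGroup.map _ (principalSubgroup R K) (homogeneousTInvertible K A).subtype le_rfl

theorem HomogeneousClassGroup.toClassGroup_injective :
    Function.Injective (HomogeneousClassGroup.toClassGroup K A) := by
  rw [injective_iff_map_eq_one]
  intro x
  induction x using QuotientGroup.induction_on with
  | H I =>
    intro h
    rw [QuotientGroup.eq_one_iff, Subgroup.mem_subgroupOf]
    exact (QuotientGroup.eq_one_iff _).1 h

/-- `HCl(R)` viewed as a subgroup of `Cl(R)`. -/
noncomputable def HCl : Subgroup (TClassGroup R K) :=
  (HomogeneousClassGroup.toClassGroup K A).range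

/-- The homogeneous elements of degree `α ∈ ⟨Γ⟩` of the homogeneous quotient field `R_S ⊆ K`:
the fractions `a / b` with `a ∈ R_β`, `0 ≠ b ∈ R_γ` and `α = β - γ`. -/
def fractionComponent (α : Algebra.GrothendieckAddGroup Γ) : Set K :=
  {x | ∃ β γ : Γ, ∃ a ∈ A β, ∃ b ∈ A γ, b ≠ 0 ∧
    α = Algebra.GrothendieckAddGroup.of β - Algebra.GrothendieckAddGroup.of γ ∧
    x = algebraMap R K a / algebraMap R K b}

/-- `R` is almost normal: every homogeneous element of `R_S` of nonzero degree that is integral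
over `R` lies in `R`. -/
def IsAlmostNormal : Prop :=
  ∀ α : Algebra.GrothendieckAddGroup Γ, α ≠ 0 → ∀ x ∈ fractionComponent K A α,
    IsIntegral R x → x ∈ (algebraMap R K).range

end Graded

/-- The extension `A ⊆ B` is inert: whenever `0 ≠ xy ∈ A` with `x, y ∈ B`, there are `r, s ∈ A`
and a unit `u` of `B` with `x = ru` and `y = su⁻¹`. -/
def IsInert {B : Type*} [CommRing B] (A : Subring B) : Prop :=
  ∀ x y : B, x * y ≠ 0 → x * y ∈ A →
    ∃ r ∈ A, ∃ s ∈ A, ∃ u : Bˣ, x = r * u ∧ y = s * (u⁻¹ : Bˣ)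

end GradedClassGroup

namespace GradedClassGroup

open scoped nonZeroDivisors
open FractionalIdeal GradedRing

set_option linter.unusedSectionVars false

/-! Suppose `R` is almost normal, and let `I` be `t`-invertible. There are finite sets `T ⊆ I` and
`T' ⊆ I⁻¹` whose products `ab` lie in `R` and have `v`-closure containing `1`. Since `⟨Γ⟩` is
torsion-free, any finite subset of `R` lies, up to a homogeneous unit of `R_S`, in a polynomial ring
over the field `(R_S)_0`. So gcds exist there, and some `u` in `K` moves both `uT` and `u⁻¹T'` into
`R_S` (`exists_scaling`). Let `F` be generated by `uT`. Then `F_v = uI`, so it is enough that `F⁻¹`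
be homogeneous. This follows from a Gauss lemma, `IsAlmostNormal.dvd_proj_mul_proj`: a homogeneous
`s` dividing `yf` divides every product `y_i f_j`. Valuations show that `y_i f_j / s` is integral
over `R`; almost normality puts it in `R` when its degree is nonzero, and inertness of `R_0` reduces
the degree zero case to that one.

Conversely, let `x = a/b` be homogeneous of degree `α ≠ 0` and integral, with homogeneous equation
`P(x) = 0`, where `P(T) = ∑ r_i T^i` is monic of degree `n`. Put `f = P(1)` and let `g` be `b^n`
times `(P(1) - P(x))/(1 - x)`, so that `(b - a) g = b^(n+1) f`. The ideal `I = (f, b - a)` is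
`t`-invertible, because `f` and `b^(n+1)` belong to `I I⁻¹` and `f = 1 + (terms in degrees kα, k >
0)` is regular modulo homogeneous elements. If a multiple of `I_t` is homogeneous, then the multiple
of `b - a` is itself homogeneous. Comparing one component of the multiples of `f` and `b - a` gives
`b - a = cb` with `c` in `R`, so `x = 1 - c` is in `R`. -/

theorem twoUniqueSums_of_isAddTorsionFree (G : Type*) [AddCommGroup G] [IsAddTorsionFree G] :
    TwoUniqueSums G :=
  -- The divisible hull is a `ℚ`-vector space, where the property is known, and torsion-freeness
  -- embeds `G` in it.
  TwoUniqueSums.of_injective_addHom (DivisibleHull.coeAddMonoidHom G : G →ₙ+ DivisibleHull G)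
    DivisibleHull.coe_injective inferInstance

theorem twoUniqueSums_of_grothendieckAddGroup (Γ : Type*) [AddCancelCommMonoid Γ]
    [IsAddTorsionFree (Algebra.GrothendieckAddGroup Γ)] : TwoUniqueSums Γ :=
  TwoUniqueSums.of_injective_addHom
    (Algebra.GrothendieckAddGroup.of (M := Γ) : Γ →ₙ+ Algebra.GrothendieckAddGroup Γ)
    Algebra.GrothendieckAddGroup.of_injective (twoUniqueSums_of_isAddTorsionFree _)

/-! ### Homogeneous components of products and of divisors -/

section Components

variable {Γ : Type*} [AddCancelCommMonoid Γ] [DecidableEq Γ] {R : Type*} [CommRing R]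
  (A : Γ → AddSubgroup R) [GradedRing A]

theorem proj_mem (i : Γ) (x : R) : proj A i x ∈ A i := SetLike.coe_mem _

variable {A}

theorem proj_of_mem {i : Γ} {x : R} (hx : x ∈ A i) : proj A i x = x :=
  DirectSum.decompose_of_mem_same A hx

theorem proj_of_mem_ne {i j : Γ} {x : R} (hx : x ∈ A i) (h : i ≠ j) : proj A j x = 0 :=
  DirectSum.decompose_of_mem_ne A hx h

theorem proj_mul_of_left_mem {i : Γ} {a : R} (ha : a ∈ A i) (b : R) (j : Γ) :
    proj A (i + j) (a * b) = a * proj A j b :=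
  DirectSum.coe_decompose_mul_add_of_left_mem A ha

theorem proj_mul_of_right_mem {j : Γ} (a : R) {b : R} (hb : b ∈ A j) (i : Γ) :
    proj A (i + j) (a * b) = proj A i a * b :=
  DirectSum.coe_decompose_mul_add_of_right_mem A hb

variable (A)

open scoped Classical in
/-- The set of degrees in which `x` has a nonzero component. -/
noncomputable def degrees (x : R) : Finset Γ := DFinsupp.support (DirectSum.decompose A x)

variable {A}

theorem mem_degrees {x : R} {i : Γ} : i ∈ degrees A x ↔ proj A i x ≠ 0 := by
  classical
  rw [degrees, DFinsupp.mem_support_iff, Ne, ← ZeroMemClass.coe_eq_zero]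
  rfl

theorem notMem_degrees {x : R} {i : Γ} : i ∉ degrees A x ↔ proj A i x = 0 := by
  rw [mem_degrees, not_not]

theorem sum_degrees_proj (x : R) : ∑ i ∈ degrees A x, proj A i x = x := by
  classical
  exact DirectSum.sum_support_decompose A x

theorem degrees_nonempty {x : R} (hx : x ≠ 0) : (degrees A x).Nonempty := by
  rw [Finset.nonempty_iff_ne_empty]
  intro h
  apply hx
  rw [← sum_degrees_proj (A := A) x, h, Finset.sum_empty]

theorem proj_mul (x y : R) (n : Γ) : proj A n (x * y) =
    ∑ p ∈ degrees A x ×ˢ degrees A y with p.1 + p.2 = n, proj A p.1 x * proj A p.2 y := by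
  classical
  rw [proj_apply, DirectSum.decompose_mul]
  exact DirectSum.coe_mul_apply A _ _ n

theorem dvd_proj {s x : R} (hs : SetLike.IsHomogeneousElem A s) (h : s ∣ x) (i : Γ) :
    s ∣ proj A i x := by
  rw [← Ideal.mem_span_singleton] at h ⊢
  exact Ideal.homogeneous_span A _ (by simpa using hs) i h

theorem ext_proj {x y : R} (h : ∀ i, proj A i x = proj A i y) : x = y := by
  apply (DirectSum.decompose A).injective
  ext i
  exact h i

/-- If `s ∣ x` in degree `i` and the component is nonzero, the quotient is homogeneous. -/
theorem exists_mem_of_dvd [IsDomain R] {s x : R} {d i : Γ} (hs : s ∈ A d) (hs0 : s ≠ 0)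
    (hx : x ∈ A i) (hx0 : x ≠ 0) (h : s ∣ x) : ∃ j, ∃ q ∈ A j, x = s * q ∧ d + j = i := by
  obtain ⟨q, rfl⟩ := h
  obtain ⟨j, hj⟩ := degrees_nonempty (A := A) (right_ne_zero_of_mul hx0)
  have key : ∀ j ∈ degrees A q, d + j = i := by
    intro j hj
    by_contra hne
    have h1 := proj_mul_of_left_mem hs q j
    rw [proj_of_mem_ne hx (Ne.symm hne)] at h1
    exact mul_ne_zero hs0 (mem_degrees.1 hj) h1.symm
  refine ⟨j, q, ?_, rfl, key j hj⟩
  have : proj A j q = q := by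
    conv_rhs => rw [← sum_degrees_proj (A := A) q]
    rw [Finset.sum_eq_single_of_mem j hj]
    intro k hk hkj
    exact absurd (add_left_cancel ((key k hk).trans (key j hj).symm)) hkj
  rw [← this]
  exact proj_mem A j q

/-- A degree that arises from a unique pair of degrees of `x` and `y` cannot cancel in `xy`. If `x`
had two degrees, there would be two such pairs, with distinct sums, whereas `xy` lives in one
degree. -/
theorem isHomogeneousElem_of_mul [IsDomain R] [TwoUniqueSums Γ] {x y : R} (hxy : x * y ≠ 0)
    (h : SetLike.IsHomogeneousElem A (x * y)) : SetLike.IsHomogeneousElem A x := by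
  obtain ⟨d, hd⟩ := h
  have hx := left_ne_zero_of_mul hxy
  have hy := right_ne_zero_of_mul hxy
  have hB := degrees_nonempty (A := A) hx
  have hC := degrees_nonempty (A := A) hy
  have huniq : ∀ b ∈ degrees A x, ∀ c ∈ degrees A y, UniqueAdd (degrees A x) (degrees A y) b c →
      b + c = d := by
    intro b hb c hc hu
    by_contra hne
    have h1 := proj_mul (A := A) x y (b + c)
    rw [proj_of_mem_ne hd (Ne.symm hne),
      Finset.sum_eq_single_of_mem (b, c) (by simp [hb, hc])] at h1
    · exact mul_ne_zero (mem_degrees.1 hb) (mem_degrees.1 hc) h1.symm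
    · rintro ⟨b', c'⟩ hp hne'
      simp only [Finset.mem_filter, Finset.mem_product] at hp
      obtain ⟨h1, h2⟩ := hu hp.1.1 hp.1.2 hp.2
      exact absurd (Prod.ext h1 h2) hne'
  have hcard : (degrees A x).card ≤ 1 := by
    by_contra! hlt
    obtain ⟨p, hp, q, hq, hpq, hup, huq⟩ := TwoUniqueSums.uniqueAdd_of_one_lt_card
      (A := degrees A x) (B := degrees A y) (by
        have := hC.card_pos
        nlinarith)
    rw [Finset.mem_product] at hp hq
    have h1 := huniq _ hp.1 _ hp.2 hup
    have h2 := huniq _ hq.1 _ hq.2 huq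
    obtain ⟨h3, h4⟩ := hup hq.1 hq.2 (h2.trans h1.symm)
    exact hpq (Prod.ext h3.symm h4.symm)
  obtain ⟨b, hb⟩ := hB
  refine ⟨b, ?_⟩
  have : proj A b x = x := by
    conv_rhs => rw [← sum_degrees_proj (A := A) x]
    rw [Finset.sum_eq_single_of_mem b hb]
    intro k hk hkj
    exact absurd (Finset.card_le_one.1 hcard k hk b hb) hkj
  rw [← this]
  exact proj_mem A b x

end Components

/-! ### Integrality of products of components, via valuations -/

section Integrality

variable {Γ : Type*} [AddCancelCommMonoid Γ] [DecidableEq Γ] {R : Type*} [CommRing R]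
  {K : Type*} [Field K] [Algebra R K]

/-- The integral closure of a subring of `K` is the intersection of the valuation rings containing
it; a monic equation over the image of `R` is then lifted to `R`. -/
theorem isIntegral_of_forall_valuationSubring {x : K}
    (h : ∀ V : ValuationSubring K, (∀ r : R, algebraMap R K r ∈ V) → x ∈ V) : IsIntegral R x := by
  have hx : x ∈
      (integralClosure (Subring.closure ((algebraMap R K).range : Set K)) K).toSubring := by
    rw [← iInf_valuationSubring_superset, Subring.mem_iInf]
    exact fun V => h V fun r => V.2 ⟨r, rfl⟩
  rw [Subring.closure_eq] at hx
  obtain ⟨p, hp, hpx⟩ := hx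
  obtain ⟨q, rfl, -, hq⟩ := Polynomial.lifts_and_natDegree_eq_and_monic
    (f := (algebraMap R K).rangeRestrict) (p := p) (by
      rw [Polynomial.lifts_iff_coeff_lifts]
      exact fun n => (algebraMap R K).rangeRestrict_surjective _) hp
  refine ⟨q, hq, ?_⟩
  rw [Polynomial.eval₂_map] at hpx
  exact hpx

variable {A : Γ → AddSubgroup R} [GradedRing A]

/-- Gauss's lemma for the content of graded elements at a valuation. -/
theorem valuation_proj_mul_proj_le [UniqueSums Γ] {G₀ : Type*} [LinearOrderedCommGroupWithZero G₀]
    (v : Valuation R G₀) {y f : R} {c : G₀} (h : ∀ n, v (proj A n (y * f)) ≤ c) (i j : Γ) :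
    v (proj A i y * proj A j f) ≤ c := by
  classical
  by_cases hi : v (proj A i y) = 0
  · rw [map_mul, hi, zero_mul]; exact _root_.zero_le
  by_cases hj : v (proj A j f) = 0
  · rw [map_mul, hj, mul_zero]; exact _root_.zero_le
  have hiy : i ∈ degrees A y := mem_degrees.2 fun h0 => hi (by rw [h0, map_zero])
  have hjf : j ∈ degrees A f := mem_degrees.2 fun h0 => hj (by rw [h0, map_zero])
  obtain ⟨i₀, hi₀, hmi⟩ := (degrees A y).exists_max_image (fun k => v (proj A k y)) ⟨i, hiy⟩
  obtain ⟨j₀, hj₀, hmj⟩ := (degrees A f).exists_max_image (fun k => v (proj A k f)) ⟨j, hjf⟩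
  have hi₀0 : 0 < v (proj A i₀ y) := (zero_lt_iff.2 hi).trans_le (hmi i hiy)
  have hj₀0 : 0 < v (proj A j₀ f) := (zero_lt_iff.2 hj).trans_le (hmj j hjf)
  -- Among the degrees where `y` and `f` attain their maximal values, some pair has a unique sum. In
  -- that degree of `yf` a single term strictly dominates, so nothing cancels.
  obtain ⟨b, hb, c', hc, hu⟩ := UniqueSums.uniqueAdd_of_nonempty
    (A := (degrees A y).filter fun k => v (proj A k y) = v (proj A i₀ y))
    (B := (degrees A f).filter fun k => v (proj A k f) = v (proj A j₀ f))
    ⟨i₀, Finset.mem_filter.2 ⟨hi₀, rfl⟩⟩ ⟨j₀, Finset.mem_filter.2 ⟨hj₀, rfl⟩⟩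
  rw [Finset.mem_filter] at hb hc
  have hlead : v (proj A (b + c') (y * f)) = v (proj A b y) * v (proj A c' f) := by
    rw [proj_mul, ← Finset.add_sum_erase _ _ (show (b, c') ∈ _ by simp [hb.1, hc.1]), ← map_mul]
    apply Valuation.map_add_eq_of_lt_left
    refine Valuation.map_sum_lt v ?_ ?_
    · rw [map_mul, hb.2, hc.2]; exact (mul_pos hi₀0 hj₀0).ne'
    · rintro ⟨k, l⟩ hkl
      simp only [Finset.mem_erase, Finset.mem_filter, Finset.mem_product] at hkl
      obtain ⟨hne, ⟨hk, hl⟩, hsum⟩ := hkl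
      simp only [map_mul]
      rw [hb.2, hc.2]
      rcases (hmi k hk).lt_or_eq with hlt | heq
      · exact (mul_le_mul_right (hmj l hl) _).trans_lt (mul_lt_mul_of_pos_right hlt hj₀0)
      rcases (hmj l hl).lt_or_eq with hlt | heq'
      · exact (mul_le_mul_left (hmi k hk) _).trans_lt (mul_lt_mul_of_pos_left hlt hi₀0)
      obtain ⟨h1, h2⟩ := hu (Finset.mem_filter.2 ⟨hk, heq⟩) (Finset.mem_filter.2 ⟨hl, heq'⟩) hsum
      exact absurd (Prod.ext h1 h2) hne
  calc v (proj A i y * proj A j f) = v (proj A i y) * v (proj A j f) := map_mul _ _ _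
    _ ≤ v (proj A i₀ y) * v (proj A j₀ f) := mul_le_mul' (hmi i hiy) (hmj j hjf)
    _ = v (proj A (b + c') (y * f)) := by rw [hlead, hb.2, hc.2]
    _ ≤ c := h _

/-- A homogeneous `s` dividing `yf` divides all its components, so `v(s)` bounds their values at
every valuation ring containing `R`. Gauss's lemma passes the bound to `y_i f_j`. -/
theorem isIntegral_proj_mul_proj_div [UniqueSums Γ] {s y f : R}
    (hs : SetLike.IsHomogeneousElem A s) (h : s ∣ y * f) (i j : Γ) :
    IsIntegral R (algebraMap R K (proj A i y * proj A j f) / algebraMap R K s) := by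
  by_cases hs0 : algebraMap R K s = 0
  · rw [hs0, _root_.div_zero]; exact isIntegral_zero
  refine isIntegral_of_forall_valuationSubring fun V hV => ?_
  rw [← V.valuation_le_one_iff, map_div₀, div_le_one₀ (by simpa [zero_lt_iff] using hs0)]
  refine valuation_proj_mul_proj_le (A := A) (V.valuation.comap (algebraMap R K))
    (c := V.valuation (algebraMap R K s)) (fun n => ?_) i j
  obtain ⟨q, hq⟩ := dvd_proj hs h n
  rw [hq, Valuation.comap_apply, map_mul, map_mul]
  exact mul_le_of_le_one_right' ((V.valuation_le_one_iff _).2 (hV q))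

end Integrality

/-! ### Gauss's lemma for divisibility in an almost normal ring -/

section AlmostNormal

variable {Γ : Type*} [AddCancelCommMonoid Γ] [DecidableEq Γ]
  {R : Type*} [CommRing R] [IsDomain R] {K : Type*} [Field K] [Algebra R K] [IsFractionRing R K]
  {A : Γ → AddSubgroup R} [GradedRing A]

theorem algebraMap_ne_zero {x : R} (hx : x ≠ 0) : algebraMap R K x ≠ 0 := by simpa using hx

theorem dvd_of_div_mem_range {s a : R} (hs0 : s ≠ 0)
    (h : algebraMap R K a / algebraMap R K s ∈ (algebraMap R K).range) : s ∣ a := by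
  obtain ⟨q, hq⟩ := h
  refine ⟨q, IsFractionRing.injective R K ?_⟩
  have := algebraMap_ne_zero (K := K) hs0
  rw [map_mul, hq]
  field_simp

theorem IsAlmostNormal.dvd_of_isIntegral (hR : IsAlmostNormal K A) {i d : Γ} {s a : R}
    (ha : a ∈ A i) (hs : s ∈ A d) (hs0 : s ≠ 0) (hid : i ≠ d)
    (h : IsIntegral R (algebraMap R K a / algebraMap R K s)) : s ∣ a :=
  dvd_of_div_mem_range hs0 (hR _
    (sub_ne_zero.2 fun h => hid (Algebra.GrothendieckAddGroup.of_injective h)) _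
    ⟨i, d, a, ha, s, hs, hs0, rfl, rfl⟩ h)

/-- Cancelling a nonzero factor of degree zero keeps degrees. It is applied to the unit supplied by
inertness. -/
theorem mem_of_mul_unit_mem {r u p : R} {m : Γ} (hr : r ∈ A 0) (hr0 : r ≠ 0) (hp : p ∈ A m)
    (h : p = r * u) : u ∈ A m := by
  have : proj A m u = u := by
    refine ext_proj (A := A) fun i => ?_
    by_cases him : m = i
    · subst him
      rw [proj_of_mem (proj_mem A m u)]
    rw [proj_of_mem_ne (proj_mem A m u) him]
    have h1 := proj_mul_of_left_mem hr u i
    rw [zero_add, ← h, proj_of_mem_ne hp him] at h1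
    exact (mul_eq_zero.1 h1.symm).resolve_left hr0 |>.symm
  rw [← this]
  exact proj_mem A m u

/-- Almost normality settles every pair with `i + j ≠ d = deg s`. When `i + j = d`, either a
homogeneous unit of nonzero degree shifts `y_i f_j / s` out of degree zero, or `y_i f_j` is the
whole component `(yf)_d`. -/
theorem IsAlmostNormal.dvd_proj_mul_proj [UniqueSums Γ] (hR : IsAlmostNormal K A)
    (hinert : IsInert (SetLike.GradeZero.subring A)) {s y f : R}
    (hs : SetLike.IsHomogeneousElem A s) (hs0 : s ≠ 0) (h : s ∣ y * f) (i j : Γ) :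
    s ∣ proj A i y * proj A j f := by
  have hint := fun i j => isIntegral_proj_mul_proj_div (K := K) hs h i j
  obtain ⟨d, hd⟩ := hs
  have hmem := fun i j => SetLike.mul_mem_graded (proj_mem A i y) (proj_mem A j f)
  have hne : ∀ i j, i + j ≠ d → s ∣ proj A i y * proj A j f := fun i j hij =>
    hR.dvd_of_isIntegral (hmem i j) hd hs0 hij (hint i j)
  by_cases hij : i + j = d
  swap
  · exact hne i j hij
  by_cases h0 : proj A i y * proj A j f = 0
  · rw [h0]; exact dvd_zero s
  -- A second nonzero product in degree `d` has `k ≠ i` and `l ≠ j`, so the crossed pairs `(i, l)`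
  -- and `(k, j)` fall under the settled case.
  by_cases hex : ∃ k l, k + l = d ∧ (k, l) ≠ (i, j) ∧ proj A k y * proj A l f ≠ 0
  · obtain ⟨k, l, hkl, hneq, h1⟩ := hex
    have hil : i + l ≠ d := by
      rintro rfl
      have := add_left_cancel hij
      subst this
      exact hneq (by rw [add_right_cancel hkl])
    have hkj : k + j ≠ d := by
      rintro rfl
      have := add_left_cancel hkl
      subst this
      exact hneq (by rw [add_right_cancel hij])
    have hil0 : proj A i y * proj A l f ≠ 0 :=
      mul_ne_zero (left_ne_zero_of_mul h0) (right_ne_zero_of_mul h1)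
    have hkj0 : proj A k y * proj A j f ≠ 0 :=
      mul_ne_zero (left_ne_zero_of_mul h1) (right_ne_zero_of_mul h0)
    obtain ⟨m, p, hp, hpe, hm⟩ := exists_mem_of_dvd hd hs0 (hmem i l) hil0 (hne i l hil)
    obtain ⟨n, q, hq, hqe, hn⟩ := exists_mem_of_dvd hd hs0 (hmem k j) hkj0 (hne k j hkj)
    -- The quotients `p` and `q` have opposite degrees, since `(i + l) + (k + j) = 2d`. Thus `pq` is
    -- in `R_0`, and inertness yields a unit of degree `m ≠ 0`.
    have hmn : m + n = 0 := by
      apply add_left_cancel (a := d + d)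
      calc d + d + (m + n) = (d + m) + (d + n) := by abel
        _ = (i + j) + (k + l) := by rw [hm, hn]; abel
        _ = d + d + 0 := by rw [hij, hkl, add_zero]
    have hp0 : p ≠ 0 := by rintro rfl; exact hil0 (by rw [hpe, mul_zero])
    have hq0 : q ≠ 0 := by rintro rfl; exact hkj0 (by rw [hqe, mul_zero])
    obtain ⟨r, hr, -, -, u, hpu, -⟩ := hinert p q (mul_ne_zero hp0 hq0) (by
      have := SetLike.mul_mem_graded hp hq
      rwa [hmn] at this)
    have hr0 : r ≠ 0 := by rintro rfl; exact hp0 (by rw [hpu, zero_mul])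
    have hu : (u : R) ∈ A m := mem_of_mul_unit_mem hr hr0 hp hpu
    have hm0 : m ≠ 0 := by
      rintro rfl
      exact hil (by rw [← hm, add_zero])
    have hdvd : s ∣ (proj A i y * proj A j f) * u := by
      refine hR.dvd_of_isIntegral (SetLike.mul_mem_graded (hmem i j) hu) hd hs0 ?_ ?_
      · rw [hij]
        exact fun h => hm0 (add_eq_left.1 h)
      · rw [map_mul, mul_div_right_comm]
        exact (hint i j).mul isIntegral_algebraMap
    exact (Units.dvd_mul_right).1 hdvd
  · push Not at hex
    have hp := dvd_proj ⟨d, hd⟩ h d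
    rw [proj_mul, Finset.sum_eq_single_of_mem (i, j)] at hp
    · exact hp
    · simp only [Finset.mem_filter, Finset.mem_product, mem_degrees]
      exact ⟨⟨left_ne_zero_of_mul h0, right_ne_zero_of_mul h0⟩, hij⟩
    · rintro ⟨k, l⟩ hkl hne
      exact hex k l (Finset.mem_filter.1 hkl).2 hne

end AlmostNormal

/-! ### The ring of fractions with homogeneous denominators -/

section HomogeneousLocalization

variable {Γ : Type*} [AddCancelCommMonoid Γ] [DecidableEq Γ]
  {R : Type*} [CommRing R] [IsDomain R] (K : Type*) [Field K] [Algebra R K] [IsFractionRing R K]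
  (A : Γ → AddSubgroup R) [GradedRing A]

/-- The localization `R_S ⊆ K` of `R` at the nonzero homogeneous elements. -/
def homogeneousLocalization : Subring K where
  carrier := {x | ∃ s : R, s ≠ 0 ∧ SetLike.IsHomogeneousElem A s ∧
    algebraMap R K s * x ∈ (algebraMap R K).range}
  one_mem' := ⟨1, one_ne_zero, ⟨0, SetLike.GradedOne.one_mem⟩, 1, by simp⟩
  zero_mem' := ⟨1, one_ne_zero, ⟨0, SetLike.GradedOne.one_mem⟩, 0, by simp⟩
  mul_mem' := by
    rintro x y ⟨s, hs, hsh, hx⟩ ⟨t, ht, hth, hy⟩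
    refine ⟨s * t, mul_ne_zero hs ht, hsh.mul hth, ?_⟩
    convert mul_mem hx hy using 1
    rw [map_mul]; ring
  add_mem' := by
    rintro x y ⟨s, hs, hsh, hx⟩ ⟨t, ht, hth, hy⟩
    refine ⟨s * t, mul_ne_zero hs ht, hsh.mul hth, ?_⟩
    convert add_mem (mul_mem ((algebraMap R K).mem_range_self t) hx)
      (mul_mem ((algebraMap R K).mem_range_self s) hy) using 1
    rw [map_mul]; ring
  neg_mem' := by
    rintro x ⟨s, hs, hsh, hx⟩
    refine ⟨s, hs, hsh, ?_⟩
    rw [mul_neg]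
    exact neg_mem hx

variable {K A}

theorem isHomogeneousElem_one : SetLike.IsHomogeneousElem A (1 : R) :=
  ⟨0, SetLike.GradedOne.one_mem⟩

theorem exists_common_denominator {ι : Type*} (T : Finset ι) (x : ι → K)
    (h : ∀ i ∈ T, x i ∈ homogeneousLocalization K A) :
    ∃ s : R, s ≠ 0 ∧ SetLike.IsHomogeneousElem A s ∧
      ∀ i ∈ T, algebraMap R K s * x i ∈ (algebraMap R K).range := by
  classical
  induction T using Finset.induction_on with
  | empty => exact ⟨1, one_ne_zero, isHomogeneousElem_one, by simp⟩
  | insert a T _ ih =>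
    obtain ⟨s, hs, hsh, h1⟩ := ih fun i hi => h i (Finset.mem_insert_of_mem hi)
    obtain ⟨t, ht, hth, h2⟩ := h a (Finset.mem_insert_self _ _)
    refine ⟨s * t, mul_ne_zero hs ht, hsh.mul hth, fun i hi => ?_⟩
    rcases Finset.mem_insert.1 hi with rfl | hi
    · rw [map_mul, mul_assoc]; exact mul_mem ⟨s, rfl⟩ h2
    · rw [map_mul, mul_comm (algebraMap R K s), mul_assoc]
      exact mul_mem ⟨t, rfl⟩ (h1 i hi)

end HomogeneousLocalization

/-! ### The grading of `R_S`, polynomial subrings and gcds -/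

section Fractions

open Algebra (GrothendieckAddGroup)

variable {Γ : Type*} [AddCancelCommMonoid Γ] [DecidableEq Γ]
  {R : Type*} [CommRing R] [IsDomain R] (K : Type*) [Field K] [Algebra R K] [IsFractionRing R K]
  (A : Γ → AddSubgroup R) [GradedRing A]

/-- The homogeneous component of degree `α` of `R_S`, as an additive subgroup of `K`. -/
def fractionSubgroup (α : GrothendieckAddGroup Γ) : AddSubgroup K where
  carrier := {x | x = 0 ∨ x ∈ fractionComponent K A α}
  zero_mem' := Or.inl rfl
  add_mem' := by
    rintro x y (rfl | hx) (rfl | hy)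
    · exact Or.inl (add_zero 0)
    · rw [zero_add]; exact Or.inr hy
    · rw [add_zero]; exact Or.inr hx
    obtain ⟨β, γ, a, ha, b, hb, hb0, hα, rfl⟩ := hx
    obtain ⟨β', γ', a', ha', b', hb', hb0', hα', rfl⟩ := hy
    have hdeg : γ + β' = β + γ' := by
      apply GrothendieckAddGroup.of_injective
      rw [map_add, map_add, add_comm, ← sub_eq_sub_iff_add_eq_add]
      exact hα'.symm.trans hα
    refine Or.inr ⟨β + γ', γ + γ', a * b' + b * a', add_mem (SetLike.mul_mem_graded ha hb')
      (hdeg ▸ SetLike.mul_mem_graded hb ha'), b * b', SetLike.mul_mem_graded hb hb',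
      mul_ne_zero hb0 hb0', ?_, ?_⟩
    · rw [hα, map_add, map_add]; abel
    · rw [div_add_div _ _ (algebraMap_ne_zero hb0) (algebraMap_ne_zero hb0')]
      simp only [map_add, map_mul]
  neg_mem' := by
    rintro x (rfl | hx)
    · exact Or.inl neg_zero
    obtain ⟨β, γ, a, ha, b, hb, hb0, hα, rfl⟩ := hx
    exact Or.inr ⟨β, γ, -a, neg_mem ha, b, hb, hb0, hα, by rw [map_neg, neg_div]⟩

variable {K A}

theorem algebraMap_mem_fractionSubgroup {i : Γ} {a : R} (ha : a ∈ A i) :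
    algebraMap R K a ∈ fractionSubgroup K A (GrothendieckAddGroup.of i) :=
  Or.inr ⟨i, 0, a, ha, 1, SetLike.GradedOne.one_mem, one_ne_zero, by simp, by simp⟩

theorem one_mem_fractionSubgroup : (1 : K) ∈ fractionSubgroup K A 0 := by
  simpa using algebraMap_mem_fractionSubgroup (K := K) (SetLike.GradedOne.one_mem (A := A))

theorem mul_mem_fractionSubgroup {α β : GrothendieckAddGroup Γ} {x y : K}
    (hx : x ∈ fractionSubgroup K A α) (hy : y ∈ fractionSubgroup K A β) :
    x * y ∈ fractionSubgroup K A (α + β) := by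
  rcases hx with rfl | hx
  · rw [zero_mul]; exact zero_mem _
  rcases hy with rfl | hy
  · rw [mul_zero]; exact zero_mem _
  obtain ⟨β, γ, a, ha, b, hb, hb0, rfl, rfl⟩ := hx
  obtain ⟨β', γ', a', ha', b', hb', hb0', rfl, rfl⟩ := hy
  refine Or.inr ⟨β + β', γ + γ', a * a', SetLike.mul_mem_graded ha ha', b * b',
    SetLike.mul_mem_graded hb hb', mul_ne_zero hb0 hb0', ?_, ?_⟩
  · rw [map_add, map_add]; abel
  · rw [map_mul, map_mul, div_mul_div_comm]

theorem inv_mem_fractionSubgroup {α : GrothendieckAddGroup Γ} {x : K}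
    (hx : x ∈ fractionSubgroup K A α) : x⁻¹ ∈ fractionSubgroup K A (-α) := by
  rcases hx with rfl | ⟨β, γ, a, ha, b, hb, hb0, rfl, rfl⟩
  · rw [_root_.inv_zero]; exact zero_mem _
  by_cases ha0 : a = 0
  · simp [ha0]
  exact Or.inr ⟨γ, β, b, hb, a, ha, ha0, by abel, by rw [inv_div]⟩

theorem pow_mem_fractionSubgroup {α : GrothendieckAddGroup Γ} {x : K}
    (hx : x ∈ fractionSubgroup K A α) (n : ℕ) : x ^ n ∈ fractionSubgroup K A (n • α) := by
  induction n with
  | zero => simpa using one_mem_fractionSubgroup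
  | succ n ih => rw [pow_succ, succ_nsmul]; exact mul_mem_fractionSubgroup ih hx

theorem zpow_mem_fractionSubgroup {α : GrothendieckAddGroup Γ} {x : K}
    (hx : x ∈ fractionSubgroup K A α) (n : ℤ) : x ^ n ∈ fractionSubgroup K A (n • α) := by
  obtain ⟨n, rfl | rfl⟩ := n.eq_nat_or_neg
  · rw [zpow_natCast, natCast_zsmul]; exact pow_mem_fractionSubgroup hx n
  · rw [zpow_neg, neg_smul, zpow_natCast, natCast_zsmul]
    exact inv_mem_fractionSubgroup (pow_mem_fractionSubgroup hx n)

theorem prod_mem_fractionSubgroup {ι : Type*} (T : Finset ι) {α : ι → GrothendieckAddGroup Γ}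
    {x : ι → K} (hx : ∀ i ∈ T, x i ∈ fractionSubgroup K A (α i)) :
    ∏ i ∈ T, x i ∈ fractionSubgroup K A (∑ i ∈ T, α i) := by
  classical
  induction T using Finset.induction_on with
  | empty => simpa using one_mem_fractionSubgroup
  | insert a T ha ih =>
    rw [Finset.prod_insert ha, Finset.sum_insert ha]
    exact mul_mem_fractionSubgroup (hx a (Finset.mem_insert_self _ _))
      (ih fun i hi => hx i (Finset.mem_insert_of_mem hi))

theorem fractionSubgroup_le_homogeneousLocalization {α : GrothendieckAddGroup Γ} {x : K}
    (hx : x ∈ fractionSubgroup K A α) : x ∈ homogeneousLocalization K A := by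
  rcases hx with rfl | ⟨β, γ, a, ha, b, hb, hb0, rfl, rfl⟩
  · exact zero_mem _
  · exact ⟨b, hb0, ⟨γ, hb⟩, a, by rw [mul_div_cancel₀ _ (algebraMap_ne_zero hb0)]⟩

/-- Clearing a homogeneous denominator shifts the degree by `d`. This transfers independence of
distinct degrees from `R` to `R_S`. -/
theorem exists_mem_of_mul_mem_fractionSubgroup {α : GrothendieckAddGroup Γ} {x : K}
    (hx : x ∈ fractionSubgroup K A α) (hx0 : x ≠ 0) {s a : R} {d : Γ} (hs : s ∈ A d) (hs0 : s ≠ 0)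
    (h : algebraMap R K a = algebraMap R K s * x) :
    ∃ j, a ∈ A j ∧ GrothendieckAddGroup.of j = α + GrothendieckAddGroup.of d := by
  rcases hx with rfl | ⟨β, γ, p, hp, q, hq, hq0, rfl, rfl⟩
  · exact absurd rfl hx0
  have hp0 : p ≠ 0 := by rintro rfl; exact hx0 (by simp)
  have he : s * p = q * a := by
    apply IsFractionRing.injective R K
    have := algebraMap_ne_zero (K := K) hq0
    rw [map_mul, map_mul, h]
    field_simp
  obtain ⟨j, a', ha', h1, h2⟩ := exists_mem_of_dvd hq hq0 (SetLike.mul_mem_graded hs hp)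
    (mul_ne_zero hs0 hp0) ⟨a, he⟩
  have : a = a' := mul_left_cancel₀ hq0 (he.symm.trans h1)
  refine ⟨j, this ▸ ha', ?_⟩
  have h3 := congrArg GrothendieckAddGroup.of h2
  rw [map_add, map_add] at h3
  rw [eq_sub_of_add_eq' h3]
  abel

/-- Homogeneous elements of distinct degrees of `R_S` are independent. -/
theorem eq_zero_of_sum_eq_zero {ι : Type*} (T : Finset ι) {α : ι → GrothendieckAddGroup Γ}
    (hα : Set.InjOn α T) {x : ι → K} (hx : ∀ i ∈ T, x i ∈ fractionSubgroup K A (α i))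
    (h : ∑ i ∈ T, x i = 0) {i : ι} (hi : i ∈ T) : x i = 0 := by
  obtain ⟨s, hs0, ⟨d, hd⟩, hs⟩ := exists_common_denominator (A := A) T x
    fun i hi => fractionSubgroup_le_homogeneousLocalization (hx i hi)
  choose! a ha using hs
  by_contra hxi
  obtain ⟨j, haj, hj⟩ := exists_mem_of_mul_mem_fractionSubgroup (hx i hi) hxi hd hs0 (ha i hi)
  have hsum : ∑ k ∈ T, a k = 0 := by
    apply IsFractionRing.injective R K
    rw [map_sum, Finset.sum_congr rfl ha, ← Finset.mul_sum, h, mul_zero, map_zero]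
  have hproj := congrArg (proj A j) hsum
  rw [map_sum, map_zero, Finset.sum_eq_single_of_mem i hi, proj_of_mem haj] at hproj
  · have := ha i hi
    rw [hproj, map_zero] at this
    exact mul_ne_zero (algebraMap_ne_zero hs0) hxi this.symm
  · intro k hk hki
    by_cases hxk : x k = 0
    · have := ha k hk
      rw [hxk, mul_zero] at this
      have hak : a k = 0 := by simpa using this
      rw [hak, map_zero]
    obtain ⟨l, hal, hl⟩ := exists_mem_of_mul_mem_fractionSubgroup (hx k hk) hxk hd hs0 (ha k hk)
    refine proj_of_mem_ne hal ?_
    rintro rfl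
    exact hki (hα hk hi (add_right_cancel (hl.symm.trans hj)))

variable (K A)

/-- The field of elements of degree zero of `R_S`. -/
def zeroSubfield : Subfield K where
  carrier := fractionSubgroup K A 0
  mul_mem' hx hy := by simpa using mul_mem_fractionSubgroup hx hy
  one_mem' := one_mem_fractionSubgroup
  add_mem' hx hy := add_mem hx hy
  zero_mem' := zero_mem _
  neg_mem' hx := neg_mem hx
  inv_mem' x hx := by simpa using inv_mem_fractionSubgroup hx

/-- The group of degrees in which `R_S` is nonzero. -/
def degreeSubgroup : AddSubgroup (GrothendieckAddGroup Γ) where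
  carrier := {α | ∃ x ∈ fractionSubgroup K A α, x ≠ 0}
  add_mem' := by
    rintro α β ⟨x, hx, hx0⟩ ⟨y, hy, hy0⟩
    exact ⟨x * y, mul_mem_fractionSubgroup hx hy, mul_ne_zero hx0 hy0⟩
  zero_mem' := ⟨1, one_mem_fractionSubgroup, one_ne_zero⟩
  neg_mem' := by
    rintro α ⟨x, hx, hx0⟩
    exact ⟨x⁻¹, inv_mem_fractionSubgroup hx, inv_ne_zero hx0⟩

variable {K A}

section Monomials

variable {n : ℕ} {e : Fin n → GrothendieckAddGroup Γ} {u : Fin n → K}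

theorem monomial_mem_fractionSubgroup (hu : ∀ i, u i ∈ fractionSubgroup K A (e i))
    (c : zeroSubfield K A) (m : Fin n → ℕ) :
    (c : K) * ∏ i, u i ^ m i ∈ fractionSubgroup K A (∑ i, m i • e i) := by
  rw [← zero_add (∑ i, m i • e i)]
  exact mul_mem_fractionSubgroup c.2
    (prod_mem_fractionSubgroup _ fun i _ => pow_mem_fractionSubgroup (hu i) _)

theorem aeval_eq_sum_monomial (p : MvPolynomial (Fin n) (zeroSubfield K A)) :
    MvPolynomial.aeval u p =
      ∑ m ∈ p.support, ((p.coeff m : zeroSubfield K A) : K) * ∏ i, u i ^ m i := by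
  rw [MvPolynomial.aeval_def, MvPolynomial.eval₂_eq']
  rfl

theorem aeval_mem_homogeneousLocalization (hu : ∀ i, u i ∈ fractionSubgroup K A (e i))
    (p : MvPolynomial (Fin n) (zeroSubfield K A)) :
    MvPolynomial.aeval u p ∈ homogeneousLocalization K A := by
  rw [aeval_eq_sum_monomial]
  exact sum_mem fun m _ =>
    fractionSubgroup_le_homogeneousLocalization (monomial_mem_fractionSubgroup hu _ _)

/-- Homogeneous elements of independent degrees are algebraically independent. -/
theorem aeval_injective (he : LinearIndependent ℤ e)
    (hu : ∀ i, u i ∈ fractionSubgroup K A (e i)) (hu0 : ∀ i, u i ≠ 0) :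
    Function.Injective (MvPolynomial.aeval u :
      MvPolynomial (Fin n) (zeroSubfield K A) →ₐ[zeroSubfield K A] K) := by
  rw [injective_iff_map_eq_zero]
  intro p hp
  by_contra hp0
  obtain ⟨m, hm⟩ := (MvPolynomial.support_nonempty).2 hp0
  rw [aeval_eq_sum_monomial] at hp
  have := eq_zero_of_sum_eq_zero p.support (α := fun m => ∑ i, m i • e i) (fun m _ m' _ h => by
    ext i
    have h2 := Fintype.linearIndependent_iff.1 he (fun i => (m i : ℤ) - m' i) (by
      simp only [sub_smul, natCast_zsmul, Finset.sum_sub_distrib]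
      exact sub_eq_zero.2 h) i
    omega) (fun m _ => monomial_mem_fractionSubgroup hu _ _) hp hm
  rcases mul_eq_zero.1 this with h | h
  · exact MvPolynomial.mem_support_iff.1 hm (by exact_mod_cast h)
  · exact Finset.prod_ne_zero_iff.2 (fun i _ => pow_ne_zero _ (hu0 i)) h

/-- Dividing `x` by the Laurent monomial of its degree leaves a scalar of degree zero, and a high
power of `∏ u_i` clears the negative exponents. Phrased with "eventually", one `N` serves finitely
many elements. -/
theorem eventually_mul_mem_range_aeval (hu : ∀ i, u i ∈ fractionSubgroup K A (e i))
    (hu0 : ∀ i, u i ≠ 0) (c : Fin n → ℤ) {x : K}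
    (hx : x ∈ fractionSubgroup K A (∑ i, c i • e i)) :
    ∀ᶠ N : ℕ in Filter.atTop, (∏ i, u i) ^ N * x ∈ (MvPolynomial.aeval u :
      MvPolynomial (Fin n) (zeroSubfield K A) →ₐ[zeroSubfield K A] K).range := by
  have hev : ∀ᶠ N : ℕ in Filter.atTop, ∀ i, 0 ≤ (N : ℤ) + c i := by
    rw [Filter.eventually_all]
    intro i
    filter_upwards [Filter.eventually_ge_atTop (c i).natAbs] with N hN
    omega
  filter_upwards [hev] with N hN
  have hx' : x * ∏ i, u i ^ (-c i) ∈ zeroSubfield K A := by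
    have := mul_mem_fractionSubgroup hx (prod_mem_fractionSubgroup Finset.univ fun i _ =>
      zpow_mem_fractionSubgroup (hu i) (-c i))
    rwa [← Finset.sum_add_distrib, Finset.sum_eq_zero] at this
    intro i _
    rw [neg_smul, add_neg_cancel]
  refine ⟨MvPolynomial.C ⟨_, hx'⟩ * ∏ i, MvPolynomial.X i ^ ((N : ℤ) + c i).toNat, ?_⟩
  simp only [AlgHom.toRingHom_eq_coe, RingHom.coe_coe, map_mul, map_prod, map_pow,
    MvPolynomial.aeval_X, MvPolynomial.aeval_C]
  change (x * ∏ i, u i ^ (-c i)) * _ = _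
  rw [mul_assoc, ← Finset.prod_mul_distrib, mul_comm, ← Finset.prod_pow]
  congr 1
  refine Finset.prod_congr rfl fun i _ => ?_
  rw [← zpow_natCast (u i) (Int.toNat _), Int.toNat_of_nonneg (hN i), ← zpow_add₀ (hu0 i),
    ← zpow_natCast]
  congr 1
  ring

end Monomials

/-- The span of `T` over `ℤ` is finitely generated and torsion-free, hence free. It stays inside
`D`, so with `D` the degree group each basis vector is the degree of a nonzero homogeneous element.
-/
theorem exists_linearIndependent_of_subset {G : Type*} [AddCommGroup G] [IsAddTorsionFree G]
    (D : AddSubgroup G) (T : Finset G) (hT : (T : Set G) ⊆ D) :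
    ∃ (n : ℕ) (e : Fin n → G), LinearIndependent ℤ e ∧ (∀ i, e i ∈ D) ∧
      ∀ t ∈ T, ∃ c : Fin n → ℤ, t = ∑ i, c i • e i := by
  have : Module.Finite ℤ (Submodule.span ℤ (T : Set G)) := Module.Finite.span_finset ℤ T
  obtain ⟨n, b⟩ := Module.basisOfFiniteTypeTorsionFree' (R := ℤ)
    (M := Submodule.span ℤ (T : Set G))
  refine ⟨n, fun i => b i, b.linearIndependent.map' (Submodule.subtype _)
    (Submodule.ker_subtype _), fun i => ?_, fun t ht => ?_⟩
  · have h : Submodule.span ℤ (T : Set G) ≤ AddSubgroup.toIntSubmodule D := Submodule.span_le.2 hT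
    exact h (b i).2
  · refine ⟨fun i => b.repr ⟨t, Submodule.subset_span ht⟩ i, ?_⟩
    have := congrArg (Submodule.subtype _) (b.sum_repr ⟨t, Submodule.subset_span ht⟩)
    rw [map_sum] at this
    simpa using this.symm

/-- Finitely many elements of `R_S` have a greatest common divisor. -/
theorem exists_gcd_homogeneousLocalization [IsAddTorsionFree (GrothendieckAddGroup Γ)]
    {F H : Finset R} {g : R} (hg : g ≠ 0) (hF : ∃ a ∈ F, a ≠ 0)
    (h : ∀ a ∈ F, ∀ b ∈ H, g ∣ a * b) :
    ∃ d : K, d ≠ 0 ∧ (∀ a ∈ F, algebraMap R K a / d ∈ homogeneousLocalization K A) ∧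
      ∀ b ∈ H, d * algebraMap R K b / algebraMap R K g ∈ homogeneousLocalization K A := by
  classical
  choose! z hz using h
  -- The cofactors `z a b` are included so that each relation `ab = g z` can be read in the
  -- polynomial ring.
  let E : Finset R := insert g (F ∪ H ∪ (F ×ˢ H).image fun p => z p.1 p.2)
  obtain ⟨n, e, he, heD, hspan⟩ := exists_linearIndependent_of_subset (degreeSubgroup K A)
    ((E.biUnion (degrees A)).image GrothendieckAddGroup.of) (by
      intro α hα
      simp only [Finset.coe_image, Set.mem_image, Finset.mem_coe, Finset.mem_biUnion] at hα
      obtain ⟨i, ⟨a, -, hi⟩, rfl⟩ := hα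
      exact ⟨_, algebraMap_mem_fractionSubgroup (proj_mem A i a),
        algebraMap_ne_zero (mem_degrees.1 hi)⟩)
  choose u hu hu0 using heD
  have hev : ∀ᶠ N : ℕ in Filter.atTop, ∀ a ∈ E, (∏ i, u i) ^ N * algebraMap R K a ∈
      (MvPolynomial.aeval u : MvPolynomial (Fin n) (zeroSubfield K A) →ₐ[_] K).range := by
    rw [Filter.eventually_all_finset]
    intro a ha
    have : ∀ᶠ N : ℕ in Filter.atTop, ∀ i ∈ degrees A a, (∏ i, u i) ^ N *
        algebraMap R K (proj A i a) ∈
          (MvPolynomial.aeval u : MvPolynomial (Fin n) (zeroSubfield K A) →ₐ[_] K).range := by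
      rw [Filter.eventually_all_finset]
      intro i hi
      obtain ⟨c, hc⟩ := hspan (GrothendieckAddGroup.of i)
        (Finset.mem_image_of_mem _ (Finset.mem_biUnion.2 ⟨a, ha, hi⟩))
      exact eventually_mul_mem_range_aeval hu hu0 c
        (hc ▸ algebraMap_mem_fractionSubgroup (proj_mem A i a))
    filter_upwards [this] with N hN
    rw [← sum_degrees_proj (A := A) a, map_sum, Finset.mul_sum]
    exact sum_mem hN
  obtain ⟨N, hN⟩ := hev.exists
  have hw0 : (∏ i, u i) ^ N ≠ 0 := pow_ne_zero _ (Finset.prod_ne_zero_iff.2 fun i _ => hu0 i)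
  have hw : ((∏ i, u i) ^ N)⁻¹ ∈ homogeneousLocalization K A :=
    fractionSubgroup_le_homogeneousLocalization (inv_mem_fractionSubgroup
      (pow_mem_fractionSubgroup (prod_mem_fractionSubgroup _ fun i _ => hu i) N))
  set w := (∏ i, u i) ^ N
  have hinj := aeval_injective he hu hu0
  have hRS := aeval_mem_homogeneousLocalization hu
  set φ := (MvPolynomial.aeval u : MvPolynomial (Fin n) (zeroSubfield K A) →ₐ[_] K)
  choose! P hP using hN
  replace hP : ∀ a ∈ E, φ (P a) = w * algebraMap R K a := hP
  have hgE : g ∈ E := Finset.mem_insert_self _ _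
  have hFE : ∀ a ∈ F, a ∈ E := fun a ha => by simp [E, ha]
  have hHE : ∀ b ∈ H, b ∈ E := fun b hb => by simp [E, hb]
  have hzE : ∀ a ∈ F, ∀ b ∈ H, z a b ∈ E := fun a ha b hb => by
    simp only [E, Finset.mem_insert, Finset.mem_union, Finset.mem_image, Finset.mem_product]
    exact Or.inr (Or.inr ⟨(a, b), ⟨ha, hb⟩, rfl⟩)
  have hPmul : ∀ a ∈ F, ∀ b ∈ H, P g ∣ P b * P a := fun a ha b hb => by
    refine ⟨P (z a b), hinj ?_⟩
    rw [map_mul, map_mul, hP _ (hFE a ha), hP _ (hHE b hb), hP _ hgE, hP _ (hzE a ha b hb)]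
    have := congrArg (algebraMap R K) (hz a ha b hb)
    rw [map_mul, map_mul] at this
    linear_combination w * w * this
  have hP0 : ∀ a ∈ E, a ≠ 0 → P a ≠ 0 := fun a ha ha0 h0 => by
    have := hP a ha
    rw [h0, map_zero] at this
    exact mul_ne_zero hw0 (algebraMap_ne_zero ha0) this.symm
  let := UniqueFactorizationMonoid.strongNormalizationMonoid
    (α := MvPolynomial (Fin n) (zeroSubfield K A))
  let := UniqueFactorizationMonoid.toNormalizedGCDMonoid (MvPolynomial (Fin n) (zeroSubfield K A))
  set D := F.gcd P
  have hD0 : D ≠ 0 := by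
    obtain ⟨a, ha, ha0⟩ := hF
    exact fun h0 => hP0 a (hFE a ha) ha0 (Finset.gcd_eq_zero_iff.1 h0 a ha)
  have hφD0 : φ D ≠ 0 := fun h0 => hD0 (hinj (by rw [h0, map_zero]))
  refine ⟨φ D, hφD0, fun a ha => ?_, fun b hb => ?_⟩
  · obtain ⟨q, hq⟩ : D ∣ P a := Finset.gcd_dvd ha
    have h1 := hP a (hFE a ha)
    rw [hq, map_mul] at h1
    convert mul_mem hw (hRS q) using 1
    field_simp
    rw [mul_comm, ← h1]
  -- `P g` divides every `P b * P a`, hence the gcd of these products, which is `P b * D` up to a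
  -- unit.
  · obtain ⟨q, hq⟩ : P g ∣ P b * D :=
      (Finset.dvd_gcd fun a ha => hPmul a ha b hb).trans (Finset.gcd_mul_left' F P (P b)).dvd
    have h1 := congrArg φ hq
    rw [map_mul, map_mul, hP b (hHE b hb), hP g hgE] at h1
    convert hRS q using 1
    rw [div_eq_iff (algebraMap_ne_zero hg)]
    apply mul_left_cancel₀ hw0
    linear_combination h1

end Fractions

/-! ### Almost normal implies `HCl = Cl` -/

section ClassGroup

open scoped Pointwise

variable {Γ : Type*} [AddCancelCommMonoid Γ] [DecidableEq Γ]
  {R : Type*} [CommRing R] [IsDomain R] {K : Type*} [Field K] [Algebra R K] [IsFractionRing R K]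
  {A : Γ → AddSubgroup R} [GradedRing A]

theorem mul_principal_ideal (I : TInvertible R K) (x : Kˣ) :
    ((I * (principalTIdeal R K).toHomUnits x : TInvertible R K) : TIdeal R K).ideal =
      spanSingleton R⁰ (x : K) * (I : TIdeal R K).ideal := by
  have : ((I * (principalTIdeal R K).toHomUnits x : TInvertible R K) : TIdeal R K).ideal =
      tClosure ((I : TIdeal R K).ideal * spanSingleton R⁰ (x : K)) := rfl
  rw [this, mul_comm, ← spanSingleton_mul_tClosure x.ne_zero, (I : TIdeal R K).tClosure_eq]

theorem HCl_eq_top_iff : HCl K A = ⊤ ↔ ∀ I : TInvertible R K, ∃ x : K, x ≠ 0 ∧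
    IsHomogeneousFractional A (spanSingleton R⁰ x * (I : TIdeal R K).ideal) := by
  rw [HCl, MonoidHom.range_eq_top]
  constructor
  · intro h I
    obtain ⟨q, hq⟩ := h (QuotientGroup.mk I)
    obtain ⟨J, rfl⟩ := QuotientGroup.mk_surjective q
    obtain ⟨x, hx⟩ := QuotientGroup.eq.1 hq.symm
    refine ⟨x, x.ne_zero, ?_⟩
    rw [← mul_principal_ideal, hx, mul_inv_cancel_left]
    exact J.2
  · intro h q
    obtain ⟨I, rfl⟩ := QuotientGroup.mk_surjective q
    obtain ⟨x, hx0, hx⟩ := h I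
    refine ⟨QuotientGroup.mk ⟨I * (principalTIdeal R K).toHomUnits (Units.mk0 x hx0), ?_⟩, ?_⟩
    · change IsHomogeneousFractional A _
      rwa [mul_principal_ideal]
    · refine (QuotientGroup.eq.2 ?_).symm
      exact ⟨Units.mk0 x hx0, by simp⟩

theorem mem_one_iff_mem_range {x : K} :
    x ∈ (1 : FractionalIdeal R⁰ K) ↔ x ∈ (algebraMap R K).range := by
  rw [mem_one_iff]; rfl

theorem exists_finset_of_le_mul {I J L : FractionalIdeal R⁰ K}
    (hL : (L : Submodule R K).FG) (h : L ≤ I * J) : ∃ T T' : Finset K, (∀ a ∈ T, a ∈ I) ∧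
      (∀ b ∈ T', b ∈ J) ∧ ∀ y ∈ L, y ∈ Submodule.span R ((T : Set K) * (T' : Set K)) := by
  classical
  obtain ⟨s, hs⟩ := hL
  have hmem : ∀ x ∈ s, ∃ T T' : Finset K, (T : Set K) ⊆ I ∧ (T' : Set K) ⊆ J ∧
      x ∈ Submodule.span R (T * T' : Set K) := fun x hx =>
    mem_span_mul_finite_of_mem_mul (h (by
      rw [← mem_coe, ← hs]; exact Submodule.subset_span hx))
  choose! T T' hT hT' hx using hmem
  refine ⟨s.biUnion T, s.biUnion T', fun a ha => ?_, fun b hb => ?_, fun y hy => ?_⟩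
  · obtain ⟨x, hxs, hax⟩ := Finset.mem_biUnion.1 ha
    exact hT x hxs hax
  · obtain ⟨x, hxs, hbx⟩ := Finset.mem_biUnion.1 hb
    exact hT' x hxs hbx
  · rw [← mem_coe, ← hs] at hy
    refine Submodule.span_le.2 (fun x hxs => ?_) hy
    exact Submodule.span_mono (Set.mul_subset_mul
      (Finset.coe_subset.2 (Finset.subset_biUnion_of_mem T hxs))
      (Finset.coe_subset.2 (Finset.subset_biUnion_of_mem T' hxs))) (hx x hxs)

theorem mul_mem_one_of_forall_mem {T : Set K} {z y : K} (hy : y ∈ Submodule.span R T)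
    (h : ∀ a ∈ T, z * a ∈ (1 : FractionalIdeal R⁰ K)) : z * y ∈ (1 : FractionalIdeal R⁰ K) := by
  induction hy using Submodule.span_induction with
  | mem x hx => exact h x hx
  | zero => rw [mul_zero]; exact FractionalIdeal.zero_mem _
  | add x y _ _ hx hy =>
    rw [mul_add]
    exact Submodule.add_mem ((1 : FractionalIdeal R⁰ K) : Submodule R K) hx hy
  | smul r x _ hx =>
    rw [mul_smul_comm]
    exact Submodule.smul_mem ((1 : FractionalIdeal R⁰ K) : Submodule R K) r hx

theorem mul_mem_one {x y : K} (hx : x ∈ (1 : FractionalIdeal R⁰ K))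
    (hy : y ∈ (1 : FractionalIdeal R⁰ K)) : x * y ∈ (1 : FractionalIdeal R⁰ K) := by
  rw [← mul_one (1 : FractionalIdeal R⁰ K)]
  exact mul_mem_mul hx hy

/-- Two finite sets whose products lie in `R` can be scaled reciprocally into `R_S`. -/
theorem exists_scaling [IsAddTorsionFree (Algebra.GrothendieckAddGroup Γ)] {T T' : Finset K}
    (hT : ∃ a ∈ T, a ≠ 0) (h : ∀ a ∈ T, ∀ b ∈ T', a * b ∈ (algebraMap R K).range) :
    ∃ u : K, u ≠ 0 ∧ (∀ a ∈ T, u * a ∈ homogeneousLocalization K A) ∧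
      ∀ b ∈ T', u⁻¹ * b ∈ homogeneousLocalization K A := by
  classical
  have hden : ∀ T : Finset K, ∃ (c : R) (f : K → R), algebraMap R K c ≠ 0 ∧
      ∀ a ∈ T, algebraMap R K (f a) = algebraMap R K c * a := fun T => by
    obtain ⟨c, hc⟩ := IsLocalization.exist_integer_multiples_of_finset R⁰ T
    choose! f hf using hc
    exact ⟨c, f, algebraMap_ne_zero (nonZeroDivisors.coe_ne_zero c), fun a ha => by
      rw [hf a ha, Algebra.smul_def]⟩
  obtain ⟨c, f, hc, hf⟩ := hden T
  obtain ⟨c', f', hc', hf'⟩ := hden T'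
  -- With numerators `cT` and `c'T'` in `R`, the products are divisible by `cc'`. If `d` is the gcd
  -- of `cT`, the scaling factor is `u = c/d`.
  obtain ⟨d, hd0, hd, hd'⟩ := exists_gcd_homogeneousLocalization (K := K) (A := A)
    (F := T.image f) (H := T'.image f') (g := c * c') (by
      rintro h0
      rcases mul_eq_zero.1 h0 with rfl | rfl
      · exact hc (map_zero _)
      · exact hc' (map_zero _))
    (by
      obtain ⟨a, ha, ha0⟩ := hT
      refine ⟨f a, Finset.mem_image_of_mem _ ha, fun h0 => ?_⟩
      have := hf a ha
      rw [h0, map_zero] at this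
      exact mul_ne_zero hc ha0 this.symm)
    (by
      intro a' ha' b' hb'
      obtain ⟨a, ha, rfl⟩ := Finset.mem_image.1 ha'
      obtain ⟨b, hb, rfl⟩ := Finset.mem_image.1 hb'
      obtain ⟨r, hr⟩ := h a ha b hb
      refine ⟨r, IsFractionRing.injective R K ?_⟩
      rw [map_mul, map_mul, map_mul, hf a ha, hf' b hb, hr]
      ring)
  refine ⟨algebraMap R K c / d, div_ne_zero hc hd0, fun a ha => ?_, fun b hb => ?_⟩
  · convert hd _ (Finset.mem_image_of_mem f ha) using 1
    rw [hf a ha]; ring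
  · convert hd' _ (Finset.mem_image_of_mem f' hb) using 1
    rw [hf' b hb, map_mul]
    field_simp

/-- The bounds `tF ⊆ R` and `sF⁻¹ ⊆ R` allow components to be taken in `R`. An element `y` of `sF⁻¹`
satisfies `st ∣ y(tx)` for all `x` in `F`, and Gauss's lemma gives the same for each `y_i`. -/
theorem isHomogeneousFractional_inv [UniqueSums Γ] (hR : IsAlmostNormal K A)
    (hinert : IsInert (SetLike.GradeZero.subring A)) {F : FractionalIdeal R⁰ K} (hF0 : F ≠ 0)
    {s t : R} (hs0 : s ≠ 0) (hs : SetLike.IsHomogeneousElem A s) (ht0 : t ≠ 0)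
    (ht : SetLike.IsHomogeneousElem A t)
    (hF : ∀ x ∈ F, algebraMap R K t * x ∈ (algebraMap R K).range)
    (hF' : ∀ z ∈ F⁻¹, algebraMap R K s * z ∈ (1 : FractionalIdeal R⁰ K)) :
    IsHomogeneousFractional A F⁻¹ := by
  have hs' := algebraMap_ne_zero (K := K) hs0
  have ht' := algebraMap_ne_zero (K := K) ht0
  obtain ⟨H, hH⟩ := le_one_iff_exists_coeIdeal.1
    (show spanSingleton R⁰ (algebraMap R K s) * F⁻¹ ≤ 1 by
      intro y hy
      obtain ⟨z, hz, rfl⟩ := mem_singleton_mul.1 hy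
      exact hF' z hz)
  have hmem : ∀ y : R, y ∈ H ↔
      ∀ x ∈ F, algebraMap R K y / algebraMap R K s * x ∈ (1 : FractionalIdeal R⁰ K) := by
    intro y
    rw [← mem_inv_iff hF0, ← algebraMap_mem_coeIdeal (K := K), hH, mem_singleton_mul]
    constructor
    · rintro ⟨z, hz, h⟩
      rwa [h, mul_div_cancel_left₀ _ hs']
    · exact fun h => ⟨_, h, by rw [mul_div_cancel₀ _ hs']⟩
  refine ⟨s, hs0, hs, H, fun i y hy => ?_, hH.symm⟩
  rw [hmem] at hy ⊢
  intro x hx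
  obtain ⟨f, hf⟩ := hF x hx
  obtain ⟨r, hr⟩ := (mem_one_iff _).1 (hy x hx)
  have hdvd : s * t ∣ y * f := by
    refine ⟨r, IsFractionRing.injective R K ?_⟩
    rw [map_mul, map_mul, map_mul, hf, hr]
    field_simp
  have hdvd' : s * t ∣ proj A i y * f := by
    rw [← sum_degrees_proj (A := A) f, Finset.mul_sum]
    exact Finset.dvd_sum fun j _ =>
      hR.dvd_proj_mul_proj hinert (hs.mul ht) (mul_ne_zero hs0 ht0) hdvd i j
  obtain ⟨q, hq⟩ := hdvd'
  refine (mem_one_iff _).2 ⟨q, ?_⟩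
  have := congrArg (algebraMap R K) hq
  rw [map_mul, map_mul, map_mul, hf] at this
  rw [div_mul_eq_mul_div, eq_div_iff hs']
  apply mul_left_cancel₀ ht'
  rw [proj_apply] at this
  linear_combination -this

theorem IsAlmostNormal.exists_isHomogeneousFractional
    [IsAddTorsionFree (Algebra.GrothendieckAddGroup Γ)] (hR : IsAlmostNormal K A)
    (hinert : IsInert (SetLike.GradeZero.subring A)) (I : TInvertible R K) :
    ∃ x : K, x ≠ 0 ∧
      IsHomogeneousFractional A (spanSingleton R⁰ x * (I : TIdeal R K).ideal) := by
  classical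
  have := twoUniqueSums_of_grothendieckAddGroup Γ
  set I₀ := (I : TIdeal R K).ideal with hI₀
  set J₀ := ((I⁻¹ : TInvertible R K) : TIdeal R K).ideal with hJ₀
  have hIJ : tClosure (I₀ * J₀) = 1 := by
    rw [hI₀, hJ₀, ← TIdeal.mul_ideal, Units.mul_inv, TIdeal.one_ideal]
  obtain ⟨L, hL, hLfg, hL1⟩ := mem_tClosure.1
    (show (1 : K) ∈ tClosure (I₀ * J₀) by rw [hIJ]; exact one_mem_one _)
  have hL0 : L ≠ 0 := by
    rintro rfl
    rw [vClosure_zero, mem_zero_iff] at hL1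
    exact one_ne_zero hL1
  obtain ⟨T, T', hT, hT', hspan⟩ := exists_finset_of_le_mul hLfg hL
  have hprod : ∀ y ∈ I₀, ∀ b ∈ T', y * b ∈ (1 : FractionalIdeal R⁰ K) := fun y hy b hb => by
    rw [← hIJ]; exact le_tClosure _ (mul_mem_mul hy (hT' b hb))
  -- Membership in `R` may be tested after multiplying by all products `ab`, because these span a
  -- module containing `L`, and `1` is in `L_v`.
  have hone : ∀ z : K, (∀ a ∈ T, ∀ b ∈ T', z * (a * b) ∈ (1 : FractionalIdeal R⁰ K)) →
      z ∈ (1 : FractionalIdeal R⁰ K) := fun z hz => by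
    rw [← one_mul z]
    refine (mem_vClosure hL0).1 hL1 z fun y hy => mul_mem_one_of_forall_mem (hspan y hy) ?_
    rintro _ ⟨a, ha, b, hb, rfl⟩
    exact hz a ha b hb
  have hTne : ∃ a ∈ T, a ≠ 0 := by
    by_contra! h0
    refine hL0 (le_antisymm (fun y hy => ?_) bot_le)
    have hle : Submodule.span R ((T : Set K) * (T' : Set K)) ≤ ⊥ := by
      rw [Submodule.span_le]
      rintro _ ⟨a, ha, b, hb, rfl⟩
      simp [h0 a ha]
    exact (mem_zero_iff R⁰).2 ((Submodule.mem_bot R).1 (hle (hspan y hy)))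
  obtain ⟨u, hu0, hu, hu'⟩ := exists_scaling (A := A) hTne fun a ha b hb =>
    mem_one_iff_mem_range.1 (hprod a (hT a ha) b hb)
  obtain ⟨t, ht0, ht, htT⟩ := exists_common_denominator T (fun a => u * a) hu
  obtain ⟨s, hs0, hs, hsT'⟩ := exists_common_denominator T' (fun b => u⁻¹ * b) hu'
  let F : FractionalIdeal R⁰ K := spanFinset R T (fun a => u * a)
  have hFcoe : (F : Submodule R K) = Submodule.span R ((fun a => u * a) '' T) :=
    spanFinset_coe R T _
  have hFmem : ∀ a ∈ T, u * a ∈ F := fun a ha => by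
    rw [← mem_coe, hFcoe]; exact Submodule.subset_span ⟨a, ha, rfl⟩
  have hF0 : F ≠ 0 := by
    obtain ⟨a, ha, ha0⟩ := hTne
    intro h0
    have := hFmem a ha
    rw [h0, mem_zero_iff] at this
    exact mul_ne_zero hu0 ha0 this
  have hinv : IsHomogeneousFractional A F⁻¹ := by
    refine isHomogeneousFractional_inv hR hinert hF0 hs0 hs ht0 ht (fun x hx => ?_)
      (fun z hz => hone _ fun a ha b hb => ?_)
    · rw [← mem_coe, hFcoe] at hx
      rw [← mem_one_iff_mem_range]
      refine mul_mem_one_of_forall_mem hx ?_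
      rintro _ ⟨a, ha, rfl⟩
      exact mem_one_iff_mem_range.2 (htT a ha)
    · convert mul_mem_one ((mem_inv_iff hF0).1 hz _ (hFmem a ha))
        (mem_one_iff_mem_range.2 (hsT' b hb)) using 1
      field_simp
  refine ⟨u, hu0, ?_⟩
  -- One inclusion holds because `F` is finitely generated inside the `t`-ideal `uI`. For the other,
  -- `z` in `F⁻¹` and `y` in `I` give `(zua)(yb)` in `R`, and `hone` removes `ab`.
  have heq : vClosure F = spanSingleton R⁰ u * I₀ := by
    apply le_antisymm
    · have h1 : F ≤ spanSingleton R⁰ u * I₀ := by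
        rw [← coe_le_coe, hFcoe, Submodule.span_le]
        rintro _ ⟨a, ha, rfl⟩
        exact mem_singleton_mul.2 ⟨a, hT a ha, rfl⟩
      have h2 : spanSingleton R⁰ u * I₀ = tClosure (spanSingleton R⁰ u * I₀) := by
        rw [← spanSingleton_mul_tClosure hu0, (I : TIdeal R K).tClosure_eq]
      rw [h2]
      refine fun x hx => ⟨F, h1, ?_, hx⟩
      rw [hFcoe]
      exact Submodule.fg_span (T.finite_toSet.image _)
    · intro x hx
      obtain ⟨y, hy, rfl⟩ := mem_singleton_mul.1 hx
      refine (mem_vClosure hF0).2 fun z hz => hone _ fun a ha b hb => ?_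
      convert mul_mem_one (hz _ (hFmem a ha)) (hprod y hy b hb) using 1
      ring
  rw [← heq]
  exact hinv.inv (inv_ne_zero' hF0)

end ClassGroup

/-! ### Homogeneous integral equations and the elements `f` and `g` -/

theorem sub_mul_sum_sum {R : Type*} [CommRing R] {n : ℕ} {r : ℕ → R} {a b : R}
    (h : ∑ i ∈ Finset.range (n + 1), r i * (a ^ i * b ^ (n - i)) = 0) :
    (b - a) * ∑ i ∈ Finset.range (n + 1), r i * ∑ j ∈ Finset.range i, a ^ j * b ^ (n - j) =
      b ^ (n + 1) * ∑ i ∈ Finset.range (n + 1), r i := by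
  -- The geometric sum for `1 - x^i` with `x = a/b`, multiplied by `b^(n+1)`. Weighted by `r i` and
  -- summed, its last terms vanish by the equation `h`.
  have hgeom : ∀ i ≤ n, (b - a) * ∑ j ∈ Finset.range i, a ^ j * b ^ (n - j) =
      b ^ (n + 1) - b * (a ^ i * b ^ (n - i)) := by
    intro i
    induction i with
    | zero => intro _; simp [pow_succ']
    | succ i ih =>
      intro hi
      rw [Finset.sum_range_succ, mul_add, ih (by omega),
        show n - i = n - (i + 1) + 1 by omega]
      ring
  rw [Finset.mul_sum, Finset.mul_sum, ← sub_eq_zero, ← Finset.sum_sub_distrib,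
    ← neg_eq_zero, ← mul_zero b, ← h, Finset.mul_sum, ← Finset.sum_neg_distrib]
  refine Finset.sum_congr rfl fun i hi => ?_
  have := hgeom i (Nat.lt_succ_iff.1 (Finset.mem_range.1 hi))
  linear_combination -(r i) * this

section HomogeneousEquation

variable {Γ : Type*} [AddCancelCommMonoid Γ] [DecidableEq Γ] {R : Type*} [CommRing R]
  {A : Γ → AddSubgroup R} [GradedRing A]

/-- Since `Γ` need not be a group, `k - i` may fail to exist. The value `r = 0` then stands for the
missing component of `c`. -/
theorem exists_proj_mul_eq (c : R) {m : R} {i : Γ} (hm : m ∈ A i) (k : Γ) :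
    ∃ r, proj A k (c * m) = r * m ∧ (∀ j, j + i = k → r = proj A j c) ∧
      ((∀ j, j + i ≠ k) → r = 0) := by
  by_cases h : ∃ j, j + i = k
  · obtain ⟨j, rfl⟩ := h
    refine ⟨proj A j c, proj_mul_of_right_mem c hm j, fun l hl => ?_, fun hl => absurd rfl (hl j)⟩
    rw [add_right_cancel hl]
  · push Not at h
    refine ⟨0, ?_, fun j hj => absurd hj (h j), fun _ => rfl⟩
    rw [zero_mul, ← sum_degrees_proj (A := A) c, Finset.sum_mul, map_sum]
    exact Finset.sum_eq_zero fun j _ =>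
      proj_of_mem_ne (SetLike.mul_mem_graded (proj_mem A j c) hm) (h j)

/-- Multiply a monic equation of `a/b` by `b^n` and keep the component of degree `nβ`. Each `r i` is
the component of the old coefficient in degree `(n - i)(β - γ)`, and the leading `1` survives. -/
theorem exists_homogeneous_equation [IsDomain R] {K : Type*} [Field K] [Algebra R K]
    [IsFractionRing R K] {β γ : Γ} {a b : R} (ha : a ∈ A β) (hb : b ∈ A γ) (hb0 : b ≠ 0)
    (h : IsIntegral R (algebraMap R K a / algebraMap R K b)) :
    ∃ (n : ℕ) (r : ℕ → R), r n = 1 ∧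
      (∀ i ≤ n, r i = 0 ∨ ∃ d, r i ∈ A d ∧ d + (n - i) • γ = (n - i) • β) ∧
      ∑ i ∈ Finset.range (n + 1), r i * (a ^ i * b ^ (n - i)) = 0 := by
  obtain ⟨p, hp, hpx⟩ := h
  have hb' := algebraMap_ne_zero (K := K) hb0
  set n := p.natDegree
  have hmem : ∀ i, a ^ i * b ^ (n - i) ∈ A (i • β + (n - i) • γ) := fun i =>
    SetLike.mul_mem_graded (SetLike.pow_mem_graded i ha) (SetLike.pow_mem_graded (n - i) hb)
  choose r hr hr1 hr0 using fun i => exists_proj_mul_eq (p.coeff i) (hmem i) (n • β)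
  refine ⟨n, r, ?_, fun i hi => ?_, ?_⟩
  · rw [hr1 n 0 (by simp), Polynomial.Monic.coeff_natDegree hp,
      proj_of_mem (SetLike.GradedOne.one_mem (A := A))]
  · by_cases hex : ∃ d, d + (i • β + (n - i) • γ) = n • β
    · obtain ⟨d, hd⟩ := hex
      refine Or.inr ⟨d, hr1 i d hd ▸ proj_mem A d _, ?_⟩
      apply add_left_cancel (a := i • β)
      rw [← add_nsmul, Nat.add_sub_cancel' hi, ← hd]
      abel
    · push Not at hex
      exact Or.inl (hr0 i hex)
  · have hsum : ∑ i ∈ Finset.range (n + 1), p.coeff i * (a ^ i * b ^ (n - i)) = 0 := by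
      apply IsFractionRing.injective R K
      rw [Polynomial.eval₂_eq_sum_range] at hpx
      rw [map_zero, ← mul_zero (algebraMap R K b ^ n), ← hpx, Finset.mul_sum, map_sum]
      refine Finset.sum_congr rfl fun i hi => ?_
      have hi' : n = (n - i) + i := by
        have := Finset.mem_range.1 hi
        omega
      have hpow : algebraMap R K b ^ n = algebraMap R K b ^ (n - i) * algebraMap R K b ^ i := by
        rw [← pow_add, ← hi']
      rw [map_mul, map_mul, map_pow, map_pow, hpow, div_pow]
      field_simp
    have := congrArg (proj A (n • β)) hsum
    rwa [map_sum, map_zero, Finset.sum_congr rfl fun i _ => hr i] at this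

theorem nsmul_inj_of_isAddTorsionFree {Γ : Type*} [AddCancelCommMonoid Γ]
    [IsAddTorsionFree (Algebra.GrothendieckAddGroup Γ)] {β γ : Γ} (hβγ : β ≠ γ) {k : ℕ}
    (h : k • β = k • γ) : k = 0 := by
  by_contra hk
  apply hβγ
  apply Algebra.GrothendieckAddGroup.of_injective
  apply nsmul_right_injective hk
  simp only
  rw [← map_nsmul, ← map_nsmul, h]

variable [IsAddTorsionFree (Algebra.GrothendieckAddGroup Γ)] {β γ : Γ} {n : ℕ} {r : ℕ → R}

/-- An element with leading component `1` and all other degrees positive multiples of `β - γ` is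
regular modulo homogeneous elements. -/
theorem dvd_of_dvd_mul_sum (hβγ : β ≠ γ) (hrn : r n = 1)
    (hr : ∀ i ≤ n, r i = 0 ∨ ∃ d, r i ∈ A d ∧ d + (n - i) • γ = (n - i) • β) {t y : R}
    (ht : SetLike.IsHomogeneousElem A t)
    (h : t ∣ y * ∑ i ∈ Finset.range (n + 1), r i) : t ∣ y := by
  -- Here `d'` precedes `d` when `d - d'` is a positive multiple of `β - γ`; torsion-freeness makes
  -- this irreflexive. The component `(yf)_d` is `y_d` plus multiples of earlier components of `y`,
  -- so divisibility by `t` propagates.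
  let rel : Γ → Γ → Prop := fun d' d => ∃ k : ℕ, k ≠ 0 ∧ d' + k • β = d + k • γ
  have : IsStrictOrder Γ rel :=
    { irrefl := by
        rintro d ⟨k, hk, h⟩
        exact hk (nsmul_inj_of_isAddTorsionFree hβγ (add_left_cancel h))
      trans := by
        rintro d₁ d₂ d₃ ⟨k, hk, h⟩ ⟨l, hl, h'⟩
        refine ⟨k + l, by omega, ?_⟩
        rw [add_nsmul, add_nsmul, ← add_assoc, h, add_right_comm, h']
        abel }
  have key : ∀ d ∈ degrees A y, t ∣ proj A d y := by
    intro d hd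
    refine Set.WellFoundedOn.induction
      ((degrees A y).finite_toSet.wellFoundedOn (r := rel)) (P := fun d => t ∣ proj A d y)
      hd fun d _ ih => ?_
    have hd' := dvd_proj ht h d
    rw [Finset.sum_range_succ, hrn, mul_add, mul_one, map_add, Finset.mul_sum, map_sum] at hd'
    refine (dvd_add_right (Finset.dvd_sum fun i hi => ?_)).1 hd'
    have hin := Finset.mem_range.1 hi
    rcases hr i hin.le with h0 | ⟨ε, hε, hεd⟩
    · rw [h0, mul_zero, map_zero]; exact dvd_zero t
    obtain ⟨q, hq, hq1, hq0⟩ := exists_proj_mul_eq y hε d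
    rw [hq]
    apply Dvd.dvd.mul_right
    by_cases hex : ∃ j, j + ε = d
    · obtain ⟨j, hj⟩ := hex
      rw [hq1 j hj]
      by_cases hjy : j ∈ degrees A y
      · refine ih j hjy ⟨n - i, by omega, ?_⟩
        rw [← hj, ← hεd]
        abel
      · rw [notMem_degrees.1 hjy]; exact dvd_zero t
    · push Not at hex
      rw [hq0 hex]; exact dvd_zero t
  rw [← sum_degrees_proj (A := A) y]
  exact Finset.dvd_sum key

variable {a b : R}

/-- The term `r_i a^j b^(n-j)` has degree `nγ + (n - i + j)(β - γ)`. As `j < i ≤ n`, this equals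
`nγ` only for `i = n`, `j = 0`. -/
theorem proj_sum_sum (hβγ : β ≠ γ) (hn : n ≠ 0) (hrn : r n = 1)
    (hr : ∀ i ≤ n, r i = 0 ∨ ∃ d, r i ∈ A d ∧ d + (n - i) • γ = (n - i) • β)
    (ha : a ∈ A β) (hb : b ∈ A γ) :
    proj A (n • γ) (∑ i ∈ Finset.range (n + 1), r i * ∑ j ∈ Finset.range i, a ^ j * b ^ (n - j)) =
      b ^ n := by
  have hzero : ∀ i ≤ n, ∀ j < i, i ≠ n ∨ j ≠ 0 →
      proj A (n • γ) (r i * (a ^ j * b ^ (n - j))) = 0 := by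
    intro i hi j hj hne
    rcases hr i hi with h0 | ⟨d, hd, hdeg⟩
    · rw [h0, zero_mul, map_zero]
    refine proj_of_mem_ne (SetLike.mul_mem_graded hd (SetLike.mul_mem_graded
      (SetLike.pow_mem_graded j ha) (SetLike.pow_mem_graded (n - j) hb))) fun h => ?_
    have h1 : d + j • β = j • γ := by
      apply add_right_cancel (b := (n - j) • γ)
      rw [← add_nsmul, Nat.add_sub_cancel' (by omega), ← h]
      abel
    have h2 : (n - i + j) • β = (n - i + j) • γ := by
      rw [add_nsmul, add_nsmul, ← hdeg, ← h1]
      abel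
    have := nsmul_inj_of_isAddTorsionFree hβγ h2
    omega
  rw [map_sum, Finset.sum_eq_single_of_mem n (by simp), hrn, one_mul, map_sum,
    Finset.sum_eq_single_of_mem 0 (by simpa using Nat.pos_of_ne_zero hn)]
  · rw [pow_zero, one_mul, Nat.sub_zero, proj_of_mem (SetLike.pow_mem_graded n hb)]
  · intro j hj hj0
    have := hzero n le_rfl j (Finset.mem_range.1 hj) (Or.inr hj0)
    rwa [hrn, one_mul] at this
  · intro i hi hin
    rw [Finset.mul_sum, map_sum]
    exact Finset.sum_eq_zero fun j hj => hzero i (Nat.lt_succ_iff.1 (Finset.mem_range.1 hi)) j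
      (Finset.mem_range.1 hj) (Or.inl hin)

end HomogeneousEquation

/-! ### `HCl = Cl` implies almost normal -/

section Converse

variable {Γ : Type*} [AddCancelCommMonoid Γ] [DecidableEq Γ]
  {R : Type*} [CommRing R] [IsDomain R] {K : Type*} [Field K] [Algebra R K] [IsFractionRing R K]
  {A : Γ → AddSubgroup R} [GradedRing A]

theorem exists_tInvertible {I L : FractionalIdeal R⁰ K} (hI : I ≠ 0) (hL : L ≤ I * I⁻¹)
    (hLfg : (L : Submodule R K).FG) (h1 : (1 : K) ∈ vClosure L) :
    ∃ U : TInvertible R K, (U : TIdeal R K).ideal = tClosure I := by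
  have h : tClosure (I * I⁻¹) = 1 := by
    apply le_antisymm
    · rw [← tClosure_one (R := R) (K := K)]
      refine tClosure_mono ?_
      rw [mul_le]
      intro x hx y hy
      rw [mul_comm]
      exact mul_mem_one_of_mem_inv hy hx
    · rw [← spanSingleton_one, spanSingleton_le_iff_mem]
      exact ⟨L, hL, hLfg, h1⟩
  have h' : tClosure (tClosure I * tClosure I⁻¹) = 1 := by
    rw [tClosure_mul_tClosure, mul_comm, tClosure_mul_tClosure, mul_comm, h]
  exact ⟨⟨⟨tClosure I, tClosure_ne_zero hI, tClosure_tClosure _⟩,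
    ⟨tClosure I⁻¹, tClosure_ne_zero (inv_ne_zero' hI), tClosure_tClosure _⟩,
    TIdeal.ext' h', TIdeal.ext' (by
      change tClosure (tClosure I⁻¹ * tClosure I) = 1
      rw [mul_comm, h'])⟩, rfl⟩

theorem div_mem_range_of_isIntegral [IsAddTorsionFree (Algebra.GrothendieckAddGroup Γ)]
    (hcl : ∀ I : TInvertible R K, ∃ x : K, x ≠ 0 ∧
      IsHomogeneousFractional A (spanSingleton R⁰ x * (I : TIdeal R K).ideal))
    {β γ : Γ} {a b : R} (ha : a ∈ A β) (hb : b ∈ A γ) (hb0 : b ≠ 0) (hβγ : β ≠ γ)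
    (hint : IsIntegral R (algebraMap R K a / algebraMap R K b)) :
    algebraMap R K a / algebraMap R K b ∈ (algebraMap R K).range := by
  have := twoUniqueSums_of_grothendieckAddGroup Γ
  obtain ⟨n, r, hrn, hr, hsum⟩ := exists_homogeneous_equation ha hb hb0 hint
  have hn : n ≠ 0 := by
    rintro rfl
    simp [hrn] at hsum
  have hG := proj_sum_sum hβγ hn hrn hr ha hb
  have hfG := sub_mul_sum_sum hsum
  have hreg := fun t y => dvd_of_dvd_mul_sum (A := A) (t := t) (y := y) hβγ hrn hr
  set f := ∑ i ∈ Finset.range (n + 1), r i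
  set g := ∑ i ∈ Finset.range (n + 1), r i * ∑ j ∈ Finset.range i, a ^ j * b ^ (n - j)
  have hb' := algebraMap_ne_zero (K := K) hb0
  have hc0 : b - a ≠ 0 := fun h => by
    have := proj_of_mem hb
    rw [sub_eq_zero.1 h, proj_of_mem_ne ha hβγ] at this
    exact hb0 ((sub_eq_zero.1 h).trans this.symm)
  have hc0' := algebraMap_ne_zero (K := K) hc0
  set v : K := algebraMap R K (b - a) / algebraMap R K (b ^ (n + 1)) with hv
  have hbn0 := algebraMap_ne_zero (K := K) (pow_ne_zero (n + 1) hb0)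
  have hfv : algebraMap R K f = v * algebraMap R K g := by
    have := congrArg (algebraMap R K) hfG
    rw [map_mul, map_mul] at this
    rw [hv]
    field_simp
    linear_combination -this
  -- Both generators are multiples of `v = (b - a)/b^(n+1)`, because `f = vg`. Hence `1` and `v⁻¹`
  -- lie in `I⁻¹`, so that `f` and `b^(n+1) = (b - a)v⁻¹` lie in `I I⁻¹`.
  let I : FractionalIdeal R⁰ K :=
    spanSingleton R⁰ (algebraMap R K f) ⊔ spanSingleton R⁰ (algebraMap R K (b - a))
  have hfI : algebraMap R K f ∈ I := spanSingleton_le_iff_mem.1 le_sup_left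
  have hcI : algebraMap R K (b - a) ∈ I := spanSingleton_le_iff_mem.1 le_sup_right
  have hI0 : I ≠ 0 := fun h0 => by
    rw [h0, mem_zero_iff] at hcI
    exact hc0' hcI
  have hI1 : I ≤ 1 := sup_le (spanSingleton_le_iff_mem.2 (coe_mem_one _ _))
    (spanSingleton_le_iff_mem.2 (coe_mem_one _ _))
  have hIv : I ≤ spanSingleton R⁰ v := by
    refine sup_le (spanSingleton_le_iff_mem.2 ?_) (spanSingleton_le_iff_mem.2 ?_)
    · exact (mem_spanSingleton _).2 ⟨g, by rw [Algebra.smul_def, hfv, mul_comm]⟩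
    · exact (mem_spanSingleton _).2 ⟨b ^ (n + 1), by
        rw [Algebra.smul_def, hv, mul_div_cancel₀ _ hbn0]⟩
  have hv0 : v ≠ 0 := div_ne_zero hc0' hbn0
  have hone : (1 : K) ∈ I⁻¹ := (mem_inv_iff hI0).2 fun y hy => by rw [one_mul]; exact hI1 hy
  have hvinv : v⁻¹ ∈ I⁻¹ := (mem_inv_iff hI0).2 fun y hy => by
    obtain ⟨q, rfl⟩ := (mem_spanSingleton _).1 (hIv hy)
    rw [Algebra.smul_def, mul_comm, mul_assoc, mul_inv_cancel₀ hv0, mul_one]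
    exact coe_mem_one _ _
  let L : FractionalIdeal R⁰ K :=
    spanSingleton R⁰ (algebraMap R K f) ⊔ spanSingleton R⁰ (algebraMap R K (b ^ (n + 1)))
  have hfL : algebraMap R K f ∈ L := spanSingleton_le_iff_mem.1 le_sup_left
  have hbL : algebraMap R K (b ^ (n + 1)) ∈ L := spanSingleton_le_iff_mem.1 le_sup_right
  have hL0 : L ≠ 0 := fun h0 => by
    rw [h0, mem_zero_iff] at hbL
    exact hbn0 hbL
  have hL : L ≤ I * I⁻¹ := by
    refine sup_le (spanSingleton_le_iff_mem.2 ?_) (spanSingleton_le_iff_mem.2 ?_)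
    · rw [← mul_one (algebraMap R K f)]
      exact mul_mem_mul hfI hone
    · have : algebraMap R K (b ^ (n + 1)) = algebraMap R K (b - a) * v⁻¹ := by
        rw [hv, inv_div, mul_div_cancel₀ _ hc0']
      rw [this]
      exact mul_mem_mul hcI hvinv
  -- If `zf` and `y = z b^(n+1)` are in `R`, then `b^(n+1)` divides `yf`, hence `y` by regularity of
  -- `f`, so `z` is in `R`.
  have hL1 : (1 : K) ∈ vClosure L := by
    refine (mem_vClosure hL0).2 fun z hz => ?_
    rw [one_mul]
    obtain ⟨q, hq⟩ := (mem_one_iff _).1 (hz _ hfL)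
    obtain ⟨y, hy⟩ := (mem_one_iff _).1 (hz _ hbL)
    obtain ⟨w, rfl⟩ := hreg (b ^ (n + 1)) y ⟨_, SetLike.pow_mem_graded (n + 1) hb⟩
      ⟨q, IsFractionRing.injective R K (by
        rw [map_mul, map_mul, hq, hy]; ring)⟩
    refine (mem_one_iff _).2 ⟨w, ?_⟩
    apply mul_left_cancel₀ hbn0
    rw [← map_mul, hy, mul_comm]
  obtain ⟨U, hU⟩ := exists_tInvertible hI0 hL (sup_fg (spanSingleton_fg _) (spanSingleton_fg _)) hL1
  obtain ⟨h, hh0, s, hs0, hs, H, hH, hHe⟩ := hcl U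
  rw [hU] at hHe
  have hs' := algebraMap_ne_zero (K := K) hs0
  have hmem : ∀ m : R, m ∈ H ↔ ∃ y ∈ tClosure I, algebraMap R K m = algebraMap R K s * h * y := by
    intro m
    rw [← algebraMap_mem_coeIdeal (K := K), ← hHe, ← mul_assoc, spanSingleton_mul_spanSingleton,
      mem_singleton_mul]
  have hIH : ∀ y ∈ I, ∃ m ∈ H, algebraMap R K m = algebraMap R K s * h * y := by
    intro y hy
    have : algebraMap R K s * h * y ∈ (H : FractionalIdeal R⁰ K) := by
      rw [← hHe, ← mul_assoc, spanSingleton_mul_spanSingleton]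
      exact mem_singleton_mul.2 ⟨y, le_tClosure I hy, rfl⟩
    obtain ⟨m, hm, hme⟩ := (mem_coeIdeal _).1 this
    exact ⟨m, hm, hme⟩
  obtain ⟨p, hpH, hp⟩ := hIH _ hcI
  obtain ⟨m, hmH, hm⟩ := hIH _ hfI
  have hp0 : p ≠ 0 := by
    rintro rfl
    rw [map_zero] at hp
    exact mul_ne_zero (mul_ne_zero hs' hh0) hc0' hp.symm
  obtain ⟨j, hjH, hj0, hj⟩ := exists_homogeneous_mem hH
    ((Submodule.ne_bot_iff H).2 ⟨p, hpH, hp0⟩)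
  obtain ⟨y, hy, hjy⟩ := (hmem j).1 hjH
  have hyv : y ∈ spanSingleton R⁰ v := by
    rw [← tClosure_spanSingleton]; exact tClosure_mono hIv hy
  obtain ⟨q, rfl⟩ := (mem_spanSingleton _).1 hyv
  -- The nonzero homogeneous `j` in `H` equals `shy` with `y` in `I_t ⊆ vR`. So `p = sh(b - a)`
  -- divides the homogeneous element `j b^(n+1)` and is itself homogeneous.
  have hpq : p * q = j * b ^ (n + 1) := by
    apply IsFractionRing.injective R K
    rw [map_mul, map_mul, hp, hjy, Algebra.smul_def, hv]
    field_simp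
  obtain ⟨i, hpi⟩ := isHomogeneousElem_of_mul (A := A) (x := p) (y := q)
    (hpq ▸ mul_ne_zero hj0 (pow_ne_zero _ hb0))
    (hpq ▸ hj.mul ⟨_, SetLike.pow_mem_graded (n + 1) hb⟩)
  have hmg : m * b ^ (n + 1) = p * g := by
    apply IsFractionRing.injective R K
    rw [map_mul, map_mul, hm, hp, hfv, hv]
    field_simp
  -- The component of `g` in degree `nγ` is `b^n`, so this degree gives `m' b^(n+1) = p b^n`. Here
  -- `m'` is a component of `m = shf`, and it lies in `H` by homogeneity.
  have hproj := congrArg (proj A (i + n • γ)) hmg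
  rw [proj_mul_of_left_mem hpi, hG] at hproj
  obtain ⟨m', hm', hm'1, hm'0⟩ :=
    exists_proj_mul_eq m (SetLike.pow_mem_graded (n + 1) hb) (i + n • γ)
  rw [hm'] at hproj
  have hm'H : m' ∈ H := by
    by_cases hex : ∃ k, k + (n + 1) • γ = i + n • γ
    · obtain ⟨k, hk⟩ := hex
      rw [hm'1 k hk]
      exact hH k hmH
    · push Not at hex
      rw [hm'0 hex]
      exact H.zero_mem
  have hpb : p = m' * b := by
    apply mul_right_cancel₀ (pow_ne_zero n hb0)
    rw [← hproj]; ring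
  obtain ⟨y, hy, hmy⟩ := (hmem m').1 hm'H
  have hy1 : y ∈ (1 : FractionalIdeal R⁰ K) := by
    rw [← tClosure_one]; exact tClosure_mono hI1 hy
  obtain ⟨c, rfl⟩ := (mem_one_iff _).1 hy1
  -- As `m' = shc` with `c` in `I_t ⊆ R`, cancelling `sh` in `p = m'b` gives `b - a = cb`.
  refine ⟨1 - c, ?_⟩
  have hfin : algebraMap R K (b - a) = algebraMap R K c * algebraMap R K b := by
    apply mul_left_cancel₀ (mul_ne_zero hs' hh0)
    rw [← hp, hpb, map_mul, hmy]; ring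
  rw [map_sub] at hfin
  rw [map_sub, map_one, eq_div_iff hb']
  linear_combination hfin

theorem isAlmostNormal_of_forall_exists [IsAddTorsionFree (Algebra.GrothendieckAddGroup Γ)]
    (hcl : ∀ I : TInvertible R K, ∃ x : K, x ≠ 0 ∧
      IsHomogeneousFractional A (spanSingleton R⁰ x * (I : TIdeal R K).ideal)) :
    IsAlmostNormal K A := by
  rintro α hα x ⟨β, γ, a, ha, b, hb, hb0, rfl, rfl⟩ hint
  refine div_mem_range_of_isIntegral hcl ha hb hb0 ?_ hint
  rintro rfl
  exact hα (sub_self _)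

end Converse

end GradedClassGroup

theorem theorem1p1 {Γ : Type*} [AddCancelCommMonoid Γ]
    [IsAddTorsionFree (Algebra.GrothendieckAddGroup Γ)] [DecidableEq Γ]
    {R : Type*} [CommRing R] [IsDomain R]
    (K : Type*) [Field K] [Algebra R K] [IsFractionRing R K]
    (A : Γ → AddSubgroup R) [GradedRing A]
    (hinert : GradedClassGroup.IsInert (SetLike.GradeZero.subring A)) :
    GradedClassGroup.HCl K A = ⊤ ↔ GradedClassGroup.IsAlmostNormal K A :=
  GradedClassGroup.HCl_eq_top_iff.trans
    ⟨GradedClassGroup.isAlmostNormal_of_forall_exists, fun h I =>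
      h.exists_isHomogeneousFractional hinert I⟩
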